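/- Let $q\ge 3$ be an integer, $\zeta:=e^{2\pi i/(2q)}$ and $\lambda:=\zeta+\overline{\zeta}=2\cos(\pi/q)$. Put $$V=\begin{pmatrix}0&-1\\1&0\end{pmatrix},\quad A_1=\begin{pmatrix}1&\lambda\\0&1\end{pmatrix},\quad A_2=\begin{pmatrix}1&0\\-\lambda&1\end{pmatrix},\qquad G_q^{mat}:=\langle V,A_1\rangle\subset SL_2(\mathbb R).$$ Let $\psi:\mathbb R^2\to\mathbb C$, $(x_1,x_2)^t\mapsto x_1+\zeta^{q-1}x_2$, which is an isomorphism of real vector spaces. For $B\in SL_2(\mathbb R)$ let $\Psi(B):=\psi\circ(\text{left multiplication by }B)\circ\psi^{-1}$, an $\mathbb R$-linear automorphism of $\mathbb C$. Put $a_1:=\Psi(A_1)$, $a_2:=\Psi(A_2)$, $G_q^{\mathbb C}:=\Psi(G_q^{mat})$ and $\Delta_q^{(1)}:=\psi\bigl(G_q^{mat}\cdot(1,0)^t\bigr)\subset\mathbb C$. For $c\in\mathbb C^*$ let $\mu_c:\mathbb C\to\mathbb C$, $z\mapsto cz$. Let $I^{(1)}$ be the skew-symmetric $\mathbb R$-bilinear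 form on $\mathbb C$ with $I^{(1)}(1,\zeta^{q-1})=-\lambda$, let $s_a^{(1)}(b):=b-I^{(1)}(a,b)\,a$ for $a,b\in\mathbb C$, and let $\Gamma^{(1)}:=\langle s^{(1)}_1,s^{(1)}_{\zeta^{q-1}}\rangle$ be the odd monodromy group. For $z\in\mathbb C$ write $\Gamma^{(1)}\{z\}$ for the orbit of $z$ under $\Gamma^{(1)}$. Finally put $\widetilde q:=q$ if $q\equiv 0\ (4)$, $\widetilde q:=q/2$ if $q\equiv 2\ (4)$, and $\widetilde q:=2q$ if $q$ is odd. Then $\Gamma^{(1)}=\langle a_1,a_2\rangle$, and the following hold. (a) (i) If $q\equiv 1\ (2)$, then $\Gamma^{(1)}=G_q^{\mathbb C}$, $\mu_{-1}\in\Gamma^{(1)}$ and $\Delta_q^{(1)}=\Gamma^{(1)}\{1\}$. (ii) If $q\equiv 0\ (4)$, then $\Gamma^{(1)}$ is a normal subgroup of index $2$ in $G_q^{\mathbb C}$, $\mu_{-1}\in\Gamma^{(1)}$, $\langle\mu_\zeta\rangle\cap\Gamma^{(1)}=\langle\mu_{\zeta^2}\rangle$ has index $2$ in $\langle\mu_\zeta\rangle$,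 and $$\Delta_q^{(1)}=\Gamma^{(1)}\{1\}\ \dot\cup\ \Gamma^{(1)}\{\zeta^{q-1}\}.$$ (iii) If $q\equiv 2\ (4)$, then $\Gamma^{(1)}$ is a normal subgroup of index $4$ in $G_q^{\mathbb C}$, $\mu_{-1}\notin\Gamma^{(1)}$, $\langle\mu_\zeta\rangle\cap\Gamma^{(1)}=\langle\mu_{\zeta^4}\rangle$ has index $4$ in $\langle\mu_\zeta\rangle$, and $$\Delta_q^{(1)}=\Gamma^{(1)}\{1\}\ \dot\cup\ \Gamma^{(1)}\{-1\}\ \dot\cup\ \Gamma^{(1)}\{\zeta^{q-1}\}\ \dot\cup\ \Gamma^{(1)}\{-\zeta^{q-1}\}.$$ (b) For every $q\ge 3$, the map $a_1\mapsto\widehat{a_1}$, $a_2\mapsto\widehat{a_2}$ extends to an isomorphism from $\Gamma^{(1)}$ to the group with presentation $$\langle\widehat{a_1},\widehat{a_2}\mid(\widehat{a_1}\widehat{a_2}\widehat{a_1}\cdots)_{[q\text{ factors}]}=(\widehat{a_2}\widehat{a_1}\widehat{a_2}\cdots)_{[q\text{ factors}]},\ (\widehat{a_1}\widehat{a_2})^{\widetilde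 q}=e\rangle.$$ -/

import Mathlib

noncomputable section

namespace OddHecke

/-- The root of unity `ζ = exp(2πi/(2q))`. -/
def zeta (q : ℕ) : ℂ := Complex.exp (2 * Real.pi * Complex.I / (2 * q))

/-- `ζ` as a unit of `ℂ`. -/
def zetaUnit (q : ℕ) : ℂˣ := Units.mk0 (zeta q) (Complex.exp_ne_zero _)

/-- `λ = 2 cos(π/q)`, which is `ζ` plus its complex conjugate. -/
def lam (q : ℕ) : ℝ := 2 * Real.cos (Real.pi / q)

/-- The matrix `V` with rows `(0, -1)` and `(1, 0)`. -/
def matV : Matrix.SpecialLinearGroup (Fin 2) ℝ :=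
  ⟨!![0, -1; 1, 0], by simp [Matrix.det_fin_two]⟩

/-- The matrix `A₁` with rows `(1, λ)` and `(0, 1)`. -/
def matA₁ (q : ℕ) : Matrix.SpecialLinearGroup (Fin 2) ℝ :=
  ⟨!![1, lam q; 0, 1], by simp [Matrix.det_fin_two]⟩

/-- The matrix `A₂` with rows `(1, 0)` and `(-λ, 1)`. -/
def matA₂ (q : ℕ) : Matrix.SpecialLinearGroup (Fin 2) ℝ :=
  ⟨!![1, 0; -lam q, 1], by simp [Matrix.det_fin_two]⟩

/-- The matrix Hecke group, generated by `V` and `A₁`. -/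
def heckeMat (q : ℕ) : Subgroup (Matrix.SpecialLinearGroup (Fin 2) ℝ) :=
  Subgroup.closure {matV, matA₁ q}

theorem im_zeta_pow_ne_zero (q : ℕ) (hq : 3 ≤ q) : (zeta q ^ (q - 1)).im ≠ 0 := by
  have hq0 : (0 : ℝ) < q := by exact_mod_cast (by omega : 0 < q)
  have hq1 : (0 : ℝ) < (q : ℝ) - 1 := by
    have : (3 : ℝ) ≤ q := by exact_mod_cast hq
    linarith
  have h : zeta q ^ (q - 1) =
      Complex.exp (((Real.pi * ((q : ℝ) - 1) / q : ℝ) : ℂ) * Complex.I) := by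
    rw [zeta, ← Complex.exp_nat_mul]
    congr 1
    have : (q : ℂ) ≠ 0 := by exact_mod_cast (by omega : q ≠ 0)
    rw [Nat.cast_sub (by omega)]
    push_cast
    field_simp
  rw [h, Complex.exp_ofReal_mul_I_im]
  refine (Real.sin_pos_of_pos_of_lt_pi ?_ ?_).ne'
  · exact div_pos (mul_pos Real.pi_pos hq1) hq0
  · rw [div_lt_iff₀ hq0]
    have := Real.pi_pos
    nlinarith

/-- The `ℝ`-linear isomorphism `ψ : ℝ² → ℂ`, `(x₁, x₂) ↦ x₁ + ζ^(q-1) x₂`. -/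
def psi (q : ℕ) (hq : 3 ≤ q) : (Fin 2 → ℝ) ≃ₗ[ℝ] ℂ where
  toFun x := x 0 + zeta q ^ (q - 1) * x 1
  invFun z := ![z.re - (zeta q ^ (q - 1)).re * (z.im / (zeta q ^ (q - 1)).im),
    z.im / (zeta q ^ (q - 1)).im]
  map_add' x y := by simp only [Pi.add_apply, Complex.ofReal_add]; ring
  map_smul' c x := by
    simp only [Pi.smul_apply, smul_eq_mul, Complex.ofReal_mul, RingHom.id_apply,
      Complex.real_smul]
    ring
  left_inv x := by
    have h := im_zeta_pow_ne_zero q hq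
    ext i
    fin_cases i <;> simp [h]
  right_inv z := by
    have h := im_zeta_pow_ne_zero q hq
    apply Complex.ext
    · simp
    · simp [mul_div_cancel₀, h]

/-- `Ψ(B) = ψ ∘ (left multiplication by B) ∘ ψ⁻¹`, for `B ∈ SL₂(ℝ)`. -/
def Psi (q : ℕ) (hq : 3 ≤ q) :
    Matrix.SpecialLinearGroup (Fin 2) ℝ →* (ℂ ≃ₗ[ℝ] ℂ) where
  toFun B := ((psi q hq).symm.trans (Matrix.SpecialLinearGroup.toLin' B)).trans (psi q hq)
  map_one' := by ext z; simp
  map_mul' A B := by ext z; simp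

/-- The group `G_q^ℂ = Ψ(G_q^mat)` of `ℝ`-linear automorphisms of `ℂ`. -/
def heckeC (q : ℕ) (hq : 3 ≤ q) : Subgroup (ℂ ≃ₗ[ℝ] ℂ) := (heckeMat q).map (Psi q hq)

/-- `a₁ = Ψ(A₁)`. -/
def a₁ (q : ℕ) (hq : 3 ≤ q) : ℂ ≃ₗ[ℝ] ℂ := Psi q hq (matA₁ q)

/-- `a₂ = Ψ(A₂)`. -/
def a₂ (q : ℕ) (hq : 3 ≤ q) : ℂ ≃ₗ[ℝ] ℂ := Psi q hq (matA₂ q)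

/-- `μ_c : ℂ → ℂ`, `z ↦ c z`, for `c ∈ ℂ^*`. -/
def mu : ℂˣ →* (ℂ ≃ₗ[ℝ] ℂ) := DistribMulAction.toModuleAut ℝ ℂ

/-- The set of odd vanishing cycles, `ψ(G_q^mat · (1, 0)^t)`. -/
def oddCycles (q : ℕ) (hq : 3 ≤ q) : Set ℂ :=
  {z | ∃ B ∈ heckeMat q, z = psi q hq (B.1.mulVec ![1, 0])}

/-- The upper triangular matrix `S` with rows `(1, -λ)` and `(0, 1)`. -/
def matS (q : ℕ) : Matrix (Fin 2) (Fin 2) ℝ := !![1, -lam q; 0, 1]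

/-- The skew-symmetric `ℝ`-bilinear form `I⁽¹⁾` on `ℂ` whose Gram matrix with respect to
the basis `(1, ζ^(q-1))` is `S - Sᵗ`. -/
def oddForm (q : ℕ) (hq : 3 ≤ q) : LinearMap.BilinForm ℝ ℂ :=
  (Matrix.toBilin' (matS q - (matS q).transpose)).comp
    (psi q hq).symm.toLinearMap (psi q hq).symm.toLinearMap

theorem oddForm_self (q : ℕ) (hq : 3 ≤ q) (a : ℂ) : (-(oddForm q hq a)) a = 0 := by
  simp [oddForm, matS, Matrix.toBilin'_apply, Fin.sum_univ_two]
  ring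

/-- The map `s_a⁽¹⁾ : b ↦ b - I⁽¹⁾(a, b) a`. -/
def oddTransvection (q : ℕ) (hq : 3 ≤ q) (a : ℂ) : ℂ ≃ₗ[ℝ] ℂ :=
  LinearEquiv.transvection (oddForm_self q hq a)

/-- The odd monodromy group `Γ⁽¹⁾`, generated by `s_a⁽¹⁾` for `a = 1` and `a = ζ^(q-1)`. -/
def oddMonodromy (q : ℕ) (hq : 3 ≤ q) : Subgroup (ℂ ≃ₗ[ℝ] ℂ) :=
  Subgroup.closure {oddTransvection q hq 1, oddTransvection q hq (zeta q ^ (q - 1))}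

/-- The alternating product `x y x ⋯` with `n` factors, starting with `x`. -/
def altProd {G : Type*} [Group G] (x y : G) : ℕ → G
  | 0 => 1
  | n + 1 => x * altProd y x n

/-- The number `q̃`: it is `q` if `q ≡ 0 (4)`, `q/2` if `q ≡ 2 (4)`, `2q` if `q` is odd. -/
def qTilde (q : ℕ) : ℕ := if q % 4 = 0 then q else if q % 4 = 2 then q / 2 else 2 * q

/-- The relators: the braid relation of length `q` and `(x₁ x₂)^q̃ = e`. -/
def oddRels (q : ℕ) : Set (FreeGroup (Fin 2)) :=
  {altProd (FreeGroup.of 0) (FreeGroup.of 1) q *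
      (altProd (FreeGroup.of 1) (FreeGroup.of 0) q)⁻¹,
    (FreeGroup.of 0 * FreeGroup.of 1) ^ qTilde q}

end OddHecke

end

/-!
Write `v = Ψ(V)` for the quarter turn (`quarter`) and `u = μ_ζ`. All statements take place in the
group of `ℝ`-linear automorphisms of `ℂ`, where `u = a₁ v`, `a₂ = v a₁ v⁻¹`, `v² = u^q = μ_{-1}`
and `a₁ a₂ = μ_{-ζ²}`. The relations of the presentation follow from these identities.

**Presentation.** Let `x`, `y` be the generators of the presented group. It contains a central
element `c` with `c² = 1` that acts as a sign, namely `(xy)^q` for odd `q` and `(xy)^(q/2)` for even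
`q`. Modulo `c` the group is generated by two cyclic subgroups: those of `(xy)^((q-1)/2) x` and `xy`
for odd `q`, those of `x` and `xy` for even `q`. The ping-pong lemma for the action on the real
lines in `ℂ` (`mem_of_isSign_of_quadratic`) shows that an element acting as a sign is a power of
`c`. The two ping-pong sets are the lines on which a product of two linear forms `Im (ζⁿ z)`, the
heights, is negative or positive. Hence the representation is faithful (`monodromyHom_injective`),
and one reads off whether `μ_{-1}` belongs to the monodromy group.

**Index.** The quarter turn normalizes the monodromy group and, together with it, generates the
Hecke group, so the quotient is cyclic, generated by the class of `v`, and everything depends on the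
order `d` of this class. For odd `q` the alternating product of length `q` is `v` up to sign, so
`d = 1`. For even `q` the presentation admits a homomorphism to `ℤ` with `a₁ ↦ 1`, `a₂ ↦ -1`; as `v`
and `-v` conjugate `a₁` to `a₂` they are not in the monodromy group (`conj_a₁_ne_a₂_of_even`), and
`d` is `2` or `4` according to whether or not `v² = μ_{-1}` is in it. Since `u = a₁ v`, the classes
of `u` and `v` coincide, which gives the statements on `⟨μ_ζ⟩`.

**Orbits.** The vanishing cycles are the union of the orbits of `vᵐ 1` for `0 ≤ m < d`. These are
disjoint because the stabilizer of `1` in the Hecke group is generated by `a₁`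
(`mem_zpowers_a₁_of_apply_one`). To see this, every element is written as `vᵃ M vᶜ`, where `M` is a
product of elements `uʲ v⁻¹` with `0 < j < q`, whose matrices have nonnegative entries.
-/

noncomputable section

namespace OddHecke

/-! ### Ping-pong modulo a central sign -/

/-- Ping-pong for two elements `g i` generating `P`, modulo a normal subgroup `C` of `P` that acts
trivially. The cyclic subgroups generated by the `g i` in `P ⧸ C` play ping-pong, so `P ⧸ C` is
their free product and acts faithfully. -/
theorem mem_of_smul_eq_of_ping_pong {P K α : Type*} [Group P] [Group K] [MulAction K α]
    (f : P →* K) (C : Subgroup P) [C.Normal] (hC : ∀ c ∈ C, ∀ x : α, f c • x = x)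
    (g : Bool → P) (hgen : Subgroup.closure (Set.range g) = ⊤) (X : Bool → Set α)
    (hX : ∀ i, (X i).Nonempty) (hdisj : Pairwise (Function.onFun Disjoint X))
    (hpp : ∀ i j, i ≠ j → ∀ n : ℤ, g i ^ n ∉ C → ∀ x ∈ X j, f (g i ^ n) • x ∈ X i)
    (hcard : ∃ i, g i ∉ C ∧ g i ^ 2 ∉ C) (p : P) (hp : ∀ x : α, f p • x = x) : p ∈ C := by
  let ρ : P →* Equiv.Perm α := (MulAction.toPermHom K α).comp f
  have hρ : ∀ p x, ρ p x = f p • x := fun p x => rfl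
  let φ : P ⧸ C →* Equiv.Perm α := QuotientGroup.lift C ρ (by
    intro c hc
    ext x
    simpa [hρ] using hC c hc x)
  have hφ : ∀ p : P, φ (p : P ⧸ C) = ρ p := fun p => rfl
  let H : Bool → Subgroup (P ⧸ C) := fun i => Subgroup.zpowers (g i : P ⧸ C)
  let ι : Monoid.CoprodI (fun i => H i) →* P ⧸ C := Monoid.CoprodI.lift fun i => (H i).subtype
  have hcomp : Monoid.CoprodI.lift (fun i => φ.comp (H i).subtype) = φ.comp ι := by
    ext i x
    simp [ι]
  have hinj : Function.Injective (φ.comp ι) := by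
    rw [← hcomp]
    refine Monoid.CoprodI.lift_injective_of_ping_pong _ (Or.inr ?_) X hX hdisj ?_
    · obtain ⟨i, h1, h2⟩ := hcard
      refine ⟨i, ?_⟩
      let y : H i := ⟨(g i : P ⧸ C), Subgroup.mem_zpowers _⟩
      have hy : y ≠ 1 := by
        intro h
        exact h1 ((QuotientGroup.eq_one_iff _).1 (congrArg Subtype.val h))
      have hy2 : y ^ 2 ≠ 1 := by
        intro h
        exact h2 ((QuotientGroup.eq_one_iff _).1 (congrArg Subtype.val h))
      have : Function.Injective (![1, y, y ^ 2] : Fin 3 → H i) := by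
        have h3 : y ≠ y ^ 2 := by
          intro h
          rw [pow_two] at h
          exact hy (by simpa using h)
        intro a b hab
        fin_cases a <;> fin_cases b <;>
          first
          | rfl
          | exact (hy hab).elim
          | exact (hy hab.symm).elim
          | exact (hy2 hab).elim
          | exact (hy2 hab.symm).elim
          | exact (h3 hab).elim
          | exact (h3 hab.symm).elim
      simpa using Cardinal.lift_mk_le_lift_mk_of_injective this
    · rintro i j hij ⟨h, n, rfl⟩ hn
      rintro _ ⟨x, hx, rfl⟩
      refine hpp i j hij n ?_ x hx
      intro hmem
      exact hn (Subtype.ext ((QuotientGroup.eq_one_iff (g i ^ n)).2 hmem))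
  have hsurj : Function.Surjective ι := by
    rw [← MonoidHom.range_eq_top, Monoid.CoprodI.range_eq_iSup, eq_top_iff]
    rintro ⟨x⟩ -
    have hx : x ∈ Subgroup.closure (Set.range g) := hgen ▸ Subgroup.mem_top x
    have hle : Subgroup.closure (Set.range g) ≤
        (⨆ i, ((H i).subtype).range).comap (QuotientGroup.mk' C) := by
      rw [Subgroup.closure_le]
      rintro _ ⟨i, rfl⟩
      refine Subgroup.mem_iSup_of_mem i ?_
      rw [Subgroup.range_subtype]
      exact Subgroup.mem_zpowers _
    exact hle hx
  obtain ⟨w, hw⟩ := hsurj (p : P ⧸ C)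
  have h1 : (φ.comp ι) w = 1 := by
    rw [MonoidHom.comp_apply, hw, hφ]
    ext x
    simpa [hρ] using hp x
  rw [(injective_iff_map_eq_one _).1 hinj w h1, map_one] at hw
  exact (QuotientGroup.eq_one_iff p).1 hw.symm

/-- A linear automorphism that is the identity or its negative. -/
def IsSign {V : Type*} [AddCommGroup V] [Module ℝ V] (g : V ≃ₗ[ℝ] V) : Prop :=
  (∀ z, g z = z) ∨ ∀ z, g z = -z

open Pointwise in
/-- Ping-pong on the lines of a real vector space, the two sets being the lines on which a
homogeneous quadratic function is negative and positive respectively. -/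
theorem mem_of_isSign_of_quadratic {P V : Type*} [Group P] [AddCommGroup V] [Module ℝ V]
    (f : P →* (V ≃ₗ[ℝ] V)) (C : Subgroup P) [C.Normal] (hC : ∀ c ∈ C, IsSign (f c))
    (Q : V → ℝ) (hQ : ∀ (r : ℝ) z, Q (r • z) = r ^ 2 * Q z) (hneg : ∃ z, Q z < 0)
    (hpos : ∃ z, 0 < Q z) (a b : P) (hgen : Subgroup.closure {a, b} = ⊤)
    (ha : ∀ n : ℤ, a ^ n ∉ C → ∀ z, 0 < Q z → Q (f (a ^ n) z) < 0)
    (hb : ∀ n : ℤ, b ^ n ∉ C → ∀ z, Q z < 0 → 0 < Q (f (b ^ n) z))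
    (hcard : a ∉ C ∧ a ^ 2 ∉ C ∨ b ∉ C ∧ b ^ 2 ∉ C) (p : P) (hp : IsSign (f p)) : p ∈ C := by
  have hsign : ∀ g : V ≃ₗ[ℝ] V, IsSign g → ∀ S : Submodule ℝ V, g • S = S := by
    intro g hg S
    ext z
    rw [← SetLike.mem_coe, Submodule.coe_pointwise_smul, Set.mem_smul_set]
    rcases hg with hg | hg
    · simp [hg]
    · constructor
      · rintro ⟨y, hy, rfl⟩
        simpa [hg] using hy
      · intro hz
        exact ⟨-z, by simpa using hz, by simp [hg]⟩
  let X : Bool → Set (Submodule ℝ V) := fun i =>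
    {S | ∃ z, (if i then 0 < Q z else Q z < 0) ∧ S = Submodule.span ℝ {z}}
  refine mem_of_smul_eq_of_ping_pong f C (fun c hc => hsign _ (hC c hc))
    (fun i => if i then b else a) ?_ X ?_ ?_ ?_ ?_ p (hsign _ hp)
  · rw [← hgen]
    congr 1
    ext x
    simp [eq_comm]
  · rintro (_ | _)
    · obtain ⟨z, hz⟩ := hneg
      exact ⟨_, z, by simpa using hz, rfl⟩
    · obtain ⟨z, hz⟩ := hpos
      exact ⟨_, z, by simpa using hz, rfl⟩
  · have key : ∀ S, S ∈ X false → S ∈ X true → False := by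
      rintro S ⟨z, hz, rfl⟩ ⟨y, hy, hzy⟩
      simp only [Bool.false_eq_true, if_false, if_true] at hz hy
      have : y ∈ Submodule.span ℝ {z} := hzy ▸ Submodule.mem_span_singleton_self y
      obtain ⟨r, rfl⟩ := Submodule.mem_span_singleton.1 this
      rw [hQ] at hy
      nlinarith [sq_nonneg r]
    rintro (_ | _) (_ | _) hij
    · exact absurd rfl hij
    · exact Set.disjoint_left.2 fun S => key S
    · exact Set.disjoint_right.2 fun S => key S
    · exact absurd rfl hij
  · have hsp : ∀ (g : V ≃ₗ[ℝ] V) (z : V),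
        g • Submodule.span ℝ {z} = Submodule.span ℝ {g z} := by
      intro g z
      rw [Submodule.smul_span, Set.smul_set_singleton]
      rfl
    rintro (_ | _) (_ | _) hij n hn S ⟨z, hz, rfl⟩
    · exact absurd rfl hij
    · exact ⟨f (a ^ n) z, by simpa using ha n (by simpa using hn) z (by simpa using hz), hsp _ _⟩
    · exact ⟨f (b ^ n) z, by simpa using hb n (by simpa using hn) z (by simpa using hz), hsp _ _⟩
    · exact absurd rfl hij
  · rcases hcard with h | h
    · exact ⟨false, by simpa using h⟩
    · exact ⟨true, by simpa using h⟩

/-! ### Cyclic quotients -/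

/-- If `N` is normalized by `G` and the class of `v` generates `G / N` and has order `d`, then the
index of `N` in `G` is `d`. -/
theorem relIndex_eq_of_cyclic_quotient {L : Type*} [Group L] {N G : Subgroup L}
    (hnorm : (N.subgroupOf G).Normal) {v : L} (hv : v ∈ G)
    (hcover : ∀ g ∈ G, ∃ n : ℤ, v ^ n * g ∈ N) {d : ℕ}
    (hd : ∀ n : ℤ, v ^ n ∈ N ↔ (d : ℤ) ∣ n) : N.relIndex G = d := by
  let y : G ⧸ N.subgroupOf G := ((⟨v, hv⟩ : G) : G ⧸ N.subgroupOf G)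
  have hy : ∀ n : ℤ, y ^ n = 1 ↔ (d : ℤ) ∣ n := by
    intro n
    rw [← hd n]
    exact (QuotientGroup.eq_one_iff ((⟨v, hv⟩ : G) ^ n)).trans Subgroup.mem_subgroupOf
  have hord : orderOf y = d := by
    refine Nat.dvd_antisymm ?_ ?_
    · exact Int.natCast_dvd_natCast.1 (orderOf_dvd_iff_zpow_eq_one.2 ((hy d).2 dvd_rfl))
    · exact Int.natCast_dvd_natCast.1 ((hy _).1 (orderOf_dvd_iff_zpow_eq_one.1 dvd_rfl))
  have htop : Subgroup.zpowers y = ⊤ := by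
    rw [eq_top_iff]
    rintro ⟨g⟩ -
    obtain ⟨n, hn⟩ := hcover g g.2
    refine Subgroup.mem_zpowers_iff.2 ⟨-n, ?_⟩
    have : y ^ n * (g : G ⧸ N.subgroupOf G) = 1 :=
      (QuotientGroup.eq_one_iff ((⟨v, hv⟩ : G) ^ n * g)).2 (Subgroup.mem_subgroupOf.2 hn)
    rw [zpow_neg]
    exact (eq_inv_of_mul_eq_one_right this).symm
  rw [Subgroup.relIndex, Subgroup.index, ← hord, ← Nat.card_zpowers, htop]
  exact (Subgroup.card_top).symm

/-! ### Alternating products -/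

theorem altProd_add_two {G : Type*} [Group G] (x y : G) (n : ℕ) :
    altProd x y (n + 2) = x * y * altProd x y n := by
  simp [altProd, mul_assoc]

theorem altProd_two_mul {G : Type*} [Group G] (x y : G) (k : ℕ) :
    altProd x y (2 * k) = (x * y) ^ k := by
  induction k with
  | zero => simp [altProd]
  | succ k ih => rw [Nat.mul_succ, altProd_add_two, ih, pow_succ']

theorem altProd_two_mul_add_one {G : Type*} [Group G] (x y : G) (k : ℕ) :
    altProd x y (2 * k + 1) = (x * y) ^ k * x := by
  induction k with
  | zero => simp [altProd]
  | succ k ih =>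
    rw [show 2 * (k + 1) + 1 = 2 * k + 1 + 2 by ring, altProd_add_two, ih, pow_succ',
      mul_assoc (x * y)]

theorem map_altProd {G H : Type*} [Group G] [Group H] (f : G →* H) (x y : G) (n : ℕ) :
    f (altProd x y n) = altProd (f x) (f y) n := by
  induction n generalizing x y with
  | zero => simp [altProd]
  | succ n ih => simp [altProd, ih]

/-- For an odd braid relation the fundamental element `Δ` squares to `(xy)^q` and interchanges
`x` and `y`. -/
theorem braid_odd {G : Type*} [Group G] {x y : G} {k : ℕ}
    (h : (x * y) ^ k * x = (y * x) ^ k * y) :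
    ((x * y) ^ k * x) ^ 2 = (x * y) ^ (2 * k + 1) ∧
      (x * y) ^ k * x * y = x * ((x * y) ^ k * x) ∧
      (x * y) ^ k * x * x = y * ((x * y) ^ k * x) := by
  have hxy : x * (y * x) ^ k = (x * y) ^ k * x := by
    have : SemiconjBy x (y * x) (x * y) := by simp [SemiconjBy, mul_assoc]
    exact this.pow_right k
  have hyx : y * (x * y) ^ k = (y * x) ^ k * y := by
    have : SemiconjBy y (x * y) (y * x) := by simp [SemiconjBy, mul_assoc]
    exact this.pow_right k
  refine ⟨?_, ?_, ?_⟩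
  · calc ((x * y) ^ k * x) ^ 2 = (x * y) ^ k * x * ((y * x) ^ k * y) := by rw [pow_two, ← h]
      _ = (x * y) ^ k * (x * (y * x) ^ k) * y := by simp only [mul_assoc]
      _ = (x * y) ^ k * ((x * y) ^ k * (x * y)) := by rw [hxy]; simp only [mul_assoc]
      _ = (x * y) ^ (2 * k + 1) := by rw [← pow_succ, ← pow_add]; congr 1; ring
  · nth_rewrite 2 [h]
    rw [← mul_assoc x, hxy]
  · rw [← mul_assoc y, hyx, h]

section

/-! ### Powers of the root of unity -/

variable {q : ℕ}

theorem isPrimitiveRoot_zeta (hq : 3 ≤ q) : IsPrimitiveRoot (zeta q) (2 * q) := by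
  have := Complex.isPrimitiveRoot_exp (2 * q) (by omega)
  rwa [Nat.cast_mul, Nat.cast_two] at this

theorem zeta_ne_zero (q : ℕ) : zeta q ≠ 0 := Complex.exp_ne_zero _

theorem zeta_pow_self (hq : 3 ≤ q) : zeta q ^ q = -1 := by
  have hq0 : (q : ℂ) ≠ 0 := by exact_mod_cast (by omega : q ≠ 0)
  rw [zeta, ← Complex.exp_nat_mul, ← Complex.exp_pi_mul_I]
  congr 1
  field_simp

theorem zeta_pow_pred (hq : 3 ≤ q) : zeta q ^ (q - 1) = -(zeta q)⁻¹ := by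
  rw [eq_neg_iff_add_eq_zero, ← mul_left_inj' (zeta_ne_zero q), add_mul,
    inv_mul_cancel₀ (zeta_ne_zero q), ← pow_succ, Nat.sub_add_cancel (by omega), zeta_pow_self hq]
  simp

theorem zeta_eq_exp (q : ℕ) (hq : 3 ≤ q) :
    zeta q = Complex.exp ((Real.pi / q : ℝ) * Complex.I) := by
  have hq0 : (q : ℂ) ≠ 0 := by exact_mod_cast (by omega : q ≠ 0)
  rw [zeta]
  congr 1
  push_cast
  field_simp

theorem zeta_zpow_im (hq : 3 ≤ q) (n : ℤ) : (zeta q ^ n).im = Real.sin (n * (Real.pi / q)) := by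
  rw [zeta_eq_exp q hq, ← Complex.exp_int_mul, ← Complex.exp_ofReal_mul_I_im]
  congr 2
  push_cast
  ring

theorem conj_zeta (hq : 3 ≤ q) : (starRingEnd ℂ) (zeta q) = (zeta q)⁻¹ := by
  rw [zeta_eq_exp q hq, ← Complex.exp_conj, ← Complex.exp_neg]
  congr 1
  simp

theorem zeta_zpow_im_nonneg (hq : 3 ≤ q) {n : ℤ} (h0 : 0 ≤ n) (h1 : n ≤ q) :
    0 ≤ (zeta q ^ n).im := by
  have hq0 : (0 : ℝ) < q := by exact_mod_cast (by omega : 0 < q)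
  have h0' : (0 : ℝ) ≤ n := by exact_mod_cast h0
  have h1' : (n : ℝ) ≤ q := by exact_mod_cast h1
  rw [zeta_zpow_im hq]
  refine Real.sin_nonneg_of_nonneg_of_le_pi (by positivity) ?_
  calc (n : ℝ) * (Real.pi / q) ≤ q * (Real.pi / q) := by gcongr
    _ = Real.pi := by field_simp

theorem zeta_zpow_im_pos (hq : 3 ≤ q) {n : ℤ} (h0 : 0 < n) (h1 : n < q) :
    0 < (zeta q ^ n).im := by
  have hq0 : (0 : ℝ) < q := by exact_mod_cast (by omega : 0 < q)
  have h0' : (0 : ℝ) < n := by exact_mod_cast h0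
  have h1' : (n : ℝ) < q := by exact_mod_cast h1
  rw [zeta_zpow_im hq]
  refine Real.sin_pos_of_pos_of_lt_pi (by positivity) ?_
  calc (n : ℝ) * (Real.pi / q) < q * (Real.pi / q) := by gcongr
    _ = Real.pi := by field_simp

/-! ### Heights -/

/-- The imaginary part of `ζⁿ z`. Up to the factor `sin (π/q)`, the numbers `height q 1 z` and
`height q 0 z` are the coordinates of `z` in the basis `1`, `ζ^(q-1)`. -/
def height (q : ℕ) (n : ℤ) (z : ℂ) : ℝ := (zeta q ^ n * z).im

theorem height_zpow_mul (q : ℕ) (n m : ℤ) (z : ℂ) :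
    height q n (zeta q ^ m * z) = height q (n + m) z := by
  rw [height, height, ← mul_assoc, ← zpow_add₀ (zeta_ne_zero q)]

theorem height_neg (n : ℤ) (z : ℂ) : height q n (-z) = -height q n z := by
  simp [height]

theorem height_smul (n : ℤ) (r : ℝ) (z : ℂ) : height q n (r • z) = r * height q n z := by
  simp only [height, Complex.real_smul, mul_left_comm _ (r : ℂ), Complex.im_ofReal_mul]

theorem height_add_mul_self (hq : 3 ≤ q) (n k : ℤ) (z : ℂ) :
    height q (n + q * k) z = (-1) ^ k * height q n z := by
  rw [height, zpow_add₀ (zeta_ne_zero q), zpow_mul, zpow_natCast, zeta_pow_self hq]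
  rcases Int.even_or_odd k with hk | hk
  · simp [hk.neg_one_zpow, height]
  · simp [hk.neg_one_zpow, height]

/-- Three heights of a point are linearly dependent: this is Cramer's rule for `ζⁿ`, `ζᵃ`, `ζᵇ`. -/
theorem height_mul_im (hq : 3 ≤ q) (n a b : ℤ) (z : ℂ) :
    height q n z * (zeta q ^ (b - a)).im =
      (zeta q ^ (n - a)).im * height q b z - (zeta q ^ (n - b)).im * height q a z := by
  have h : ∀ m l : ℤ, zeta q ^ (m - l) = zeta q ^ m * (starRingEnd ℂ) (zeta q ^ l) := by
    intro m l
    rw [map_zpow₀, conj_zeta hq, zpow_sub₀ (zeta_ne_zero q), inv_zpow, div_eq_mul_inv]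
  simp only [height, h, Complex.mul_im, Complex.conj_re, Complex.conj_im]
  ring

theorem lam_mul_height (hq : 3 ≤ q) (n : ℤ) (z : ℂ) :
    lam q * height q n z = height q (n + 1) z + height q (n - 1) z := by
  have hl : (lam q : ℂ) = zeta q + (zeta q)⁻¹ := by
    rw [← conj_zeta hq, Complex.add_conj, zeta_eq_exp q hq, Complex.exp_ofReal_mul_I_re, lam]
  have : ((lam q : ℂ) * (zeta q ^ n * z)) =
      zeta q ^ (n + 1) * z + zeta q ^ (n - 1) * z := by
    rw [hl, zpow_add_one₀ (zeta_ne_zero q), zpow_sub_one₀ (zeta_ne_zero q)]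
    ring
  rw [height, height, height, ← Complex.im_ofReal_mul, this, Complex.add_im]

theorem im_zeta_pos (hq : 3 ≤ q) : 0 < (zeta q).im := by
  simpa using zeta_zpow_im_pos hq (n := 1) (by norm_num) (by omega)

theorem lam_pos (hq : 3 ≤ q) : 0 < lam q := by
  have hq0 : (3 : ℝ) ≤ q := by exact_mod_cast hq
  refine mul_pos two_pos (Real.cos_pos_of_mem_Ioo ⟨?_, ?_⟩)
  · have : 0 < Real.pi / q := by positivity
    linarith [Real.pi_pos]
  · exact div_lt_div_of_pos_left Real.pi_pos (by norm_num) (by linarith)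

theorem eq_of_height_eq (hq : 3 ≤ q) {z w : ℂ} (h0 : height q 0 z = height q 0 w)
    (h1 : height q 1 z = height q 1 w) : z = w := by
  have hi : z.im = w.im := by simpa [height] using h0
  refine Complex.ext ?_ hi
  simp only [height, zpow_one, Complex.mul_im, hi, add_right_inj] at h1
  exact mul_left_cancel₀ (im_zeta_pos hq).ne' (by linarith)

theorem height_zero_psi (hq : 3 ≤ q) (x : Fin 2 → ℝ) :
    height q 0 (psi q hq x) = (zeta q).im * x 1 := by
  have : (zeta q ^ (q - 1)).im = (zeta q).im := by
    rw [zeta_pow_pred hq, ← conj_zeta hq]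
    simp
  simp [height, psi, this]

theorem height_one_psi (hq : 3 ≤ q) (x : Fin 2 → ℝ) :
    height q 1 (psi q hq x) = (zeta q).im * x 0 := by
  have : zeta q * (x 0 + zeta q ^ (q - 1) * x 1) = zeta q * x 0 - x 1 := by
    rw [zeta_pow_pred hq]
    field_simp [zeta_ne_zero q]
    ring
  have h2 : psi q hq x = x 0 + zeta q ^ (q - 1) * x 1 := rfl
  rw [height, zpow_one, h2, this]
  simp

theorem Psi_psi (hq : 3 ≤ q) (B : Matrix.SpecialLinearGroup (Fin 2) ℝ) (x : Fin 2 → ℝ) :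
    Psi q hq B (psi q hq x) = psi q hq (B.1.mulVec x) := by
  simp only [Psi, MonoidHom.coe_mk, OneHom.coe_mk, LinearEquiv.trans_apply,
    LinearEquiv.symm_apply_apply, Matrix.SpecialLinearGroup.toLin'_apply, Matrix.toLin'_apply]

theorem height_zero_Psi (hq : 3 ≤ q) (B : Matrix.SpecialLinearGroup (Fin 2) ℝ) (z : ℂ) :
    height q 0 (Psi q hq B z) = B.1 1 0 * height q 1 z + B.1 1 1 * height q 0 z := by
  obtain ⟨x, rfl⟩ := (psi q hq).surjective z
  rw [Psi_psi, height_zero_psi, height_zero_psi, height_one_psi]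
  simp [Matrix.mulVec, dotProduct, Fin.sum_univ_two]
  ring

theorem height_one_Psi (hq : 3 ≤ q) (B : Matrix.SpecialLinearGroup (Fin 2) ℝ) (z : ℂ) :
    height q 1 (Psi q hq B z) = B.1 0 0 * height q 1 z + B.1 0 1 * height q 0 z := by
  obtain ⟨x, rfl⟩ := (psi q hq).surjective z
  rw [Psi_psi, height_one_psi, height_zero_psi, height_one_psi]
  simp [Matrix.mulVec, dotProduct, Fin.sum_univ_two]
  ring

/-! ### Generators of the Hecke group -/

/-- The automorphism `Ψ(V)` of `ℂ`, a quarter turn in the basis `1`, `ζ^(q-1)`. -/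
def quarter (q : ℕ) (hq : 3 ≤ q) : ℂ ≃ₗ[ℝ] ℂ := Psi q hq matV

theorem mu_apply (c : ℂˣ) (z : ℂ) : mu c z = c * z := rfl

theorem mu_neg_one_apply (z : ℂ) : mu (-1) z = -z := by simp [mu_apply]

theorem mu_injective : Function.Injective mu := by
  intro c d h
  have := LinearEquiv.congr_fun h 1
  rw [mu_apply, mu_apply, mul_one, mul_one] at this
  exact Units.ext this

theorem commute_mu_neg_one (g : ℂ ≃ₗ[ℝ] ℂ) : Commute (mu (-1)) g := by
  ext z
  simp [mu_neg_one_apply]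

theorem mu_neg_one_sq : mu (-1) ^ 2 = 1 := by
  rw [← map_pow, neg_one_sq, map_one]

theorem mu_neg_one_ne_one : mu (-1) ≠ 1 := by
  rw [← map_one mu]
  intro h
  have := congrArg Units.val (mu_injective h)
  norm_num at this

variable (hq : 3 ≤ q)

theorem height_zero_quarter (z : ℂ) : height q 0 (quarter q hq z) = height q 1 z := by
  rw [quarter, height_zero_Psi]
  simp [matV]

theorem height_one_quarter (z : ℂ) : height q 1 (quarter q hq z) = -height q 0 z := by
  rw [quarter, height_one_Psi]
  simp [matV]

theorem height_zero_a₁ (z : ℂ) : height q 0 (a₁ q hq z) = height q 0 z := by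
  rw [a₁, height_zero_Psi]
  simp [matA₁]

theorem height_one_a₁ (z : ℂ) :
    height q 1 (a₁ q hq z) = height q 1 z + lam q * height q 0 z := by
  rw [a₁, height_one_Psi]
  simp [matA₁]

theorem quarter_sq : quarter q hq ^ 2 = mu (-1) := by
  ext z
  rw [pow_two, LinearEquiv.mul_apply, mu_neg_one_apply]
  apply eq_of_height_eq hq
  · rw [height_zero_quarter, height_one_quarter, height_neg]
  · rw [height_one_quarter, height_zero_quarter, height_neg]

theorem quarter_pow_four : quarter q hq ^ 4 = 1 := by
  rw [show 4 = 2 * 2 by rfl, pow_mul, quarter_sq, mu_neg_one_sq]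

theorem quarter_inv : (quarter q hq)⁻¹ = mu (-1) * quarter q hq := by
  rw [inv_eq_iff_mul_eq_one, ← quarter_sq hq, ← mul_assoc, ← pow_succ', ← pow_succ,
    quarter_pow_four]

theorem a₁_mul_quarter : a₁ q hq * quarter q hq = mu (zetaUnit q) := by
  ext z
  have h : mu (zetaUnit q) z = zeta q ^ (1 : ℤ) * z := by rw [zpow_one]; rfl
  rw [LinearEquiv.mul_apply, h]
  apply eq_of_height_eq hq
  · rw [height_zero_a₁, height_zero_quarter, height_zpow_mul, zero_add]
  · rw [height_one_a₁, height_zero_quarter, height_one_quarter, height_zpow_mul,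
      lam_mul_height hq]
    norm_num

theorem quarter_mul_a₁ : quarter q hq * a₁ q hq = a₂ q hq * quarter q hq := by
  simp only [quarter, a₁, a₂, ← map_mul]
  congr 1
  ext i j
  rw [Matrix.SpecialLinearGroup.coe_mul, Matrix.SpecialLinearGroup.coe_mul]
  fin_cases i <;> fin_cases j <;> simp [matV, matA₁, matA₂]

theorem quarter_mul_a₂ : quarter q hq * a₂ q hq = a₁ q hq * quarter q hq := by
  simp only [quarter, a₁, a₂, ← map_mul]
  congr 1
  ext i j
  rw [Matrix.SpecialLinearGroup.coe_mul, Matrix.SpecialLinearGroup.coe_mul]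
  fin_cases i <;> fin_cases j <;> simp [matV, matA₁, matA₂]

theorem zetaUnit_pow_self (hq : 3 ≤ q) : zetaUnit q ^ q = -1 := by
  ext
  rw [Units.val_pow_eq_pow_val]
  exact zeta_pow_self hq

theorem a₂_eq : a₂ q hq = quarter q hq * a₁ q hq * (quarter q hq)⁻¹ := by
  rw [quarter_mul_a₁, mul_inv_cancel_right]

/-- The product `a₁ a₂` is a rotation; `-ζ²` has order `q̃`, which is where `q̃` comes from. -/
theorem a₁_mul_a₂ : a₁ q hq * a₂ q hq = mu (-zetaUnit q ^ 2) := by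
  have h : -zetaUnit q ^ 2 = -1 * (zetaUnit q * zetaUnit q) := by
    rw [neg_one_mul, pow_two]
  rw [a₂_eq, quarter_inv, h, map_mul, map_mul, ← a₁_mul_quarter hq,
    (commute_mu_neg_one (a₁ q hq * quarter q hq * (a₁ q hq * quarter q hq))).eq,
    (commute_mu_neg_one (quarter q hq)).eq]
  simp only [mul_assoc]

theorem height_a₁_pow (n : ℤ) (z : ℂ) : height q 0 ((a₁ q hq ^ n) z) = height q 0 z ∧
    height q 1 ((a₁ q hq ^ n) z) = height q 1 z + n * (lam q * height q 0 z) := by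
  induction n with
  | zero => simp
  | succ n ih =>
    rw [add_comm (n : ℤ) 1, zpow_one_add, LinearEquiv.mul_apply, height_zero_a₁, height_one_a₁,
      ih.1, ih.2]
    refine ⟨rfl, ?_⟩
    push_cast
    ring
  | pred n ih =>
    have h0 := height_zero_a₁ hq ((a₁ q hq ^ (-(n : ℤ) - 1)) z)
    have h1 := height_one_a₁ hq ((a₁ q hq ^ (-(n : ℤ) - 1)) z)
    rw [← LinearEquiv.mul_apply, ← zpow_one_add, add_sub_cancel, ih.1] at h0
    rw [← LinearEquiv.mul_apply, ← zpow_one_add, add_sub_cancel, ih.2, ← h0] at h1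
    refine ⟨h0.symm, ?_⟩
    push_cast at h1 ⊢
    linarith

theorem quarter_one : quarter q hq 1 = zeta q ^ (q - 1) := by
  have h0 : height q 0 1 = 0 := by simp [height]
  apply eq_of_height_eq hq
  · rw [height_zero_quarter]
    have := height_zero_psi hq ![0, 1]
    simpa [psi, height] using this.symm
  · rw [height_one_quarter, h0]
    have := height_one_psi hq ![0, 1]
    simpa [psi] using this.symm

/-! ### The odd monodromy group -/

theorem oddTransvection_psi (x y : Fin 2 → ℝ) :
    oddTransvection q hq (psi q hq x) (psi q hq y) =
      psi q hq (y + (lam q * (x 0 * y 1 - x 1 * y 0)) • x) := by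
  have h : oddForm q hq (psi q hq x) (psi q hq y) = -(lam q * (x 0 * y 1 - x 1 * y 0)) := by
    simp only [oddForm, LinearMap.BilinForm.comp_apply, LinearEquiv.coe_coe,
      LinearEquiv.symm_apply_apply, Matrix.toBilin'_apply, Fin.sum_univ_two, matS]
    simp
    ring
  rw [oddTransvection, LinearEquiv.transvection.apply, LinearMap.neg_apply, h, neg_neg, map_add,
    map_smul]

theorem psi_one : psi q hq ![1, 0] = 1 := by simp [psi]

theorem psi_zeta : psi q hq ![0, 1] = zeta q ^ (q - 1) := by simp [psi]

theorem oddTransvection_one : oddTransvection q hq 1 = a₁ q hq := by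
  ext z
  obtain ⟨x, rfl⟩ := (psi q hq).surjective z
  rw [← psi_one hq, oddTransvection_psi, a₁, Psi_psi]
  congr 1
  ext i
  fin_cases i <;> simp [matA₁, Matrix.mulVec, dotProduct, Fin.sum_univ_two]

theorem oddTransvection_zeta : oddTransvection q hq (zeta q ^ (q - 1)) = a₂ q hq := by
  ext z
  obtain ⟨x, rfl⟩ := (psi q hq).surjective z
  rw [← psi_zeta hq, oddTransvection_psi, a₂, Psi_psi]
  congr 1
  ext i
  fin_cases i <;> simp [matA₂, Matrix.mulVec, dotProduct, Fin.sum_univ_two]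
  ring

theorem oddMonodromy_eq : oddMonodromy q hq = Subgroup.closure {a₁ q hq, a₂ q hq} := by
  rw [oddMonodromy, oddTransvection_one, oddTransvection_zeta]

theorem heckeC_eq : heckeC q hq = Subgroup.closure {quarter q hq, a₁ q hq} := by
  rw [heckeC, heckeMat, MonoidHom.map_closure, Set.image_pair]
  rfl

theorem mem_oddCycles {z : ℂ} : z ∈ oddCycles q hq ↔ ∃ g ∈ heckeC q hq, z = g 1 := by
  have h : ∀ B, Psi q hq B 1 = psi q hq (B.1.mulVec ![1, 0]) := by
    intro B
    rw [← Psi_psi, psi_one]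
  constructor
  · rintro ⟨B, hB, rfl⟩
    exact ⟨_, Subgroup.mem_map_of_mem _ hB, (h B).symm⟩
  · rintro ⟨_, ⟨B, hB, rfl⟩, rfl⟩
    exact ⟨B, hB, h B⟩

end

section

variable {q : ℕ}

/-! ### Rotations by multiples of the angle `π/q` -/

theorem height_pair_mul_self (hq : 3 ≤ q) (n l m : ℤ) (z : ℂ) :
    height q (n + m) z * height q (l + m) z =
      height q (n + m % q) z * height q (l + m % q) z := by
  have h : ∀ j : ℤ, height q (j + m) z = (-1) ^ (m / q) * height q (j + m % q) z := by
    intro j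
    rw [← height_add_mul_self hq, add_assoc, Int.emod_add_mul_ediv]
  rw [h n, h l, mul_mul_mul_comm, ← mul_zpow]
  simp

/-- A rotation that moves the line of `1` moves the open sector between `1` and `ζ⁻¹` into the
complementary sector. -/
theorem height_adjacent_pos (hq : 3 ≤ q) {m : ℤ} (hm : ¬ (q : ℤ) ∣ m) {z : ℂ}
    (hz : height q 1 z * height q 0 z < 0) : 0 < height q (1 + m) z * height q (0 + m) z := by
  rw [height_pair_mul_self hq]
  have hq0 : (0 : ℤ) < q := by omega
  have h0 := Int.emod_nonneg m hq0.ne'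
  have h1 := Int.emod_lt_of_pos m hq0
  have h2 : m % q ≠ 0 := fun h => hm (Int.dvd_of_emod_eq_zero h)
  generalize m % q = j at *
  have e1 := height_mul_im hq (1 + j) 0 1 z
  have e0 := height_mul_im hq (0 + j) 0 1 z
  have p0 : 0 ≤ (zeta q ^ (1 + j - 0)).im := zeta_zpow_im_nonneg hq (by omega) (by omega)
  have p1 : 0 < (zeta q ^ (1 + j - 1)).im := zeta_zpow_im_pos hq (by omega) (by omega)
  have p2 : 0 < (zeta q ^ (0 + j - 0)).im := zeta_zpow_im_pos hq (by omega) (by omega)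
  have p3 : 0 ≤ (zeta q ^ (0 + j - 1)).im := zeta_zpow_im_nonneg hq (by omega) (by omega)
  have ps : 0 < (zeta q ^ (1 - 0 : ℤ)).im := zeta_zpow_im_pos hq (by omega) (by omega)
  rcases mul_neg_iff.1 hz with ⟨h1, h0⟩ | ⟨h1, h0⟩
  · refine mul_pos (pos_of_mul_pos_left ?_ ps.le) (pos_of_mul_pos_left ?_ ps.le)
    · rw [e1]
      have := mul_pos_of_neg_of_neg (neg_neg_of_pos p1) h0
      nlinarith [mul_nonneg p0 h1.le]
    · rw [e0]
      nlinarith [mul_pos p2 h1, mul_nonneg p3 (neg_pos.2 h0).le]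
  · refine mul_pos_of_neg_of_neg (neg_of_mul_neg_left ?_ ps.le) (neg_of_mul_neg_left ?_ ps.le)
    · rw [e1]
      nlinarith [mul_nonneg p0 (neg_pos.2 h1).le, mul_pos p1 h0]
    · rw [e0]
      nlinarith [mul_pos p2 (neg_pos.2 h1), mul_nonneg p3 h0.le]

/-- A rotation by an angle which modulo `π` has distance at least `2π/q` from `0` moves the open
sector between `ζ` and `ζ⁻¹` into the complementary sector. -/
theorem height_gap_pos (hq : 3 ≤ q) {m : ℤ} (hm : 2 ≤ m % q) (hm' : m % q + 2 ≤ q) {z : ℂ}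
    (hz : height q 1 z * height q (-1) z < 0) :
    0 < height q (1 + m) z * height q (-1 + m) z := by
  rw [height_pair_mul_self hq]
  generalize m % q = j at *
  have e1 := height_mul_im hq (1 + j) (-1) 1 z
  have e0 := height_mul_im hq (-1 + j) (-1) 1 z
  have p0 : 0 ≤ (zeta q ^ (1 + j - -1)).im := zeta_zpow_im_nonneg hq (by omega) (by omega)
  have p1 : 0 < (zeta q ^ (1 + j - 1)).im := zeta_zpow_im_pos hq (by omega) (by omega)
  have p2 : 0 < (zeta q ^ (-1 + j - -1)).im := zeta_zpow_im_pos hq (by omega) (by omega)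
  have p3 : 0 ≤ (zeta q ^ (-1 + j - 1)).im := zeta_zpow_im_nonneg hq (by omega) (by omega)
  have ps : 0 < (zeta q ^ (1 - -1 : ℤ)).im := zeta_zpow_im_pos hq (by omega) (by omega)
  rcases mul_neg_iff.1 hz with ⟨h1, h0⟩ | ⟨h1, h0⟩
  · refine mul_pos (pos_of_mul_pos_left ?_ ps.le) (pos_of_mul_pos_left ?_ ps.le)
    · rw [e1]
      nlinarith [mul_nonneg p0 h1.le, mul_pos p1 (neg_pos.2 h0)]
    · rw [e0]
      nlinarith [mul_pos p2 h1, mul_nonneg p3 (neg_pos.2 h0).le]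
  · refine mul_pos_of_neg_of_neg (neg_of_mul_neg_left ?_ ps.le) (neg_of_mul_neg_left ?_ ps.le)
    · rw [e1]
      nlinarith [mul_nonneg p0 (neg_pos.2 h1).le, mul_pos p1 h0]
    · rw [e0]
      nlinarith [mul_pos p2 (neg_pos.2 h1), mul_nonneg p3 h0.le]

theorem height_neg_one (hq : 3 ≤ q) (z : ℂ) :
    height q (-1) z = lam q * height q 0 z - height q 1 z := by
  have := lam_mul_height hq 0 z
  norm_num at this
  linarith

/-! ### Signs -/

theorem isSign_mu_neg_one_zpow (n : ℤ) : IsSign (mu (-1) ^ n) := by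
  rw [← map_zpow]
  rcases Int.even_or_odd n with hn | hn
  · rw [hn.neg_one_zpow]
    exact Or.inl fun z => by simp
  · rw [hn.neg_one_zpow]
    exact Or.inr mu_neg_one_apply

theorem IsSign.mu_sq_eq_one {c : ℂˣ} (h : IsSign (mu c)) : c ^ 2 = 1 := by
  have h1 : (c : ℂ) = 1 ∨ (c : ℂ) = -1 := by
    rcases h with h | h
    · left; simpa [mu_apply] using h 1
    · right; simpa [mu_apply] using h 1
  ext
  rcases h1 with h1 | h1 <;> simp [h1]

theorem not_isSign_a₁_zpow (hq : 3 ≤ q) {n : ℤ} (hn : n ≠ 0) : ¬ IsSign (a₁ q hq ^ n) := by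
  have hI : height q 0 Complex.I = 1 := by simp [height]
  obtain ⟨h0, h1⟩ := height_a₁_pow hq n Complex.I
  rintro (h | h)
  · rw [h, hI, left_eq_add, mul_one] at h1
    exact mul_ne_zero (by exact_mod_cast hn) (lam_pos hq).ne' h1
  · rw [h, height_neg, hI] at h0
    norm_num at h0

theorem height_pair_of_isSign {g : ℂ ≃ₗ[ℝ] ℂ} (hg : IsSign g) (n l : ℤ) (z : ℂ) :
    height q n (g z) * height q l (g z) = height q n z * height q l z := by
  rcases hg with h | h <;> simp [h, height_neg]

theorem mu_neg_zeta_sq_zpow_apply (n : ℤ) (z : ℂ) :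
    mu ((-zetaUnit q ^ 2) ^ n) z = ((-1) ^ n : ℝ) • (zeta q ^ (2 * n) * z) := by
  have h1 : ((-zetaUnit q ^ 2 : ℂˣ) : ℂ) = -1 * zeta q ^ 2 := by
    rw [neg_one_mul]
    rfl
  rw [mu_apply, Units.val_zpow_eq_zpow_val, h1, mul_zpow, zpow_mul, Complex.real_smul]
  push_cast
  rw [mul_assoc]
  rfl

/-! ### The representation of the presented group -/

section relations

variable (hq : 3 ≤ q)

/-- For even `q` the alternating product of length `q` is a sign. -/
theorem a₁_mul_a₂_pow_of_even {k : ℕ} (hk : q = 2 * k) :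
    (a₁ q hq * a₂ q hq) ^ k = mu (-1) ^ (k + 1) := by
  rw [a₁_mul_a₂, ← map_pow, ← map_pow, neg_pow, ← pow_mul, ← hk, zetaUnit_pow_self hq, pow_succ]

/-- For odd `q` the alternating product of length `q` is the quarter turn up to sign. -/
theorem a₁_mul_a₂_pow_of_odd {k : ℕ} (hk : q = 2 * k + 1) :
    (a₁ q hq * a₂ q hq) ^ k * a₁ q hq = mu (-1) ^ (k + 1) * (quarter q hq)⁻¹ := by
  rw [eq_mul_inv_iff_mul_eq, mul_assoc, a₁_mul_quarter, a₁_mul_a₂, ← map_pow, ← map_mul,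
    ← map_pow, neg_pow, ← pow_mul, mul_assoc, ← pow_succ, ← hk, zetaUnit_pow_self hq, pow_succ]

theorem commute_quarter_altProd :
    Commute (quarter q hq) (altProd (a₁ q hq) (a₂ q hq) q) := by
  have hs : ∀ n : ℕ, Commute (quarter q hq) (mu (-1) ^ n) := fun n =>
    (commute_mu_neg_one _).symm.pow_right n
  rcases Nat.even_or_odd' q with ⟨k, hk | hk⟩
  · have := a₁_mul_a₂_pow_of_even hq hk
    rw [← altProd_two_mul, ← hk] at this
    rw [this]
    exact hs _
  · have := a₁_mul_a₂_pow_of_odd hq hk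
    rw [← altProd_two_mul_add_one, ← hk] at this
    rw [this]
    exact (hs _).mul_right (Commute.refl _).inv_right

/-- Conjugation by the quarter turn interchanges `a₁` and `a₂` and fixes their alternating
product of length `q`, whence the braid relation. -/
theorem altProd_braid : altProd (a₁ q hq) (a₂ q hq) q = altProd (a₂ q hq) (a₁ q hq) q := by
  have h := map_altProd (MulAut.conj (quarter q hq)).toMonoidHom (a₁ q hq) (a₂ q hq) q
  simp only [MulEquiv.toMonoidHom_eq_coe, MonoidHom.coe_coe, MulAut.conj_apply] at h
  rwa [quarter_mul_a₁, quarter_mul_a₂, mul_inv_cancel_right, mul_inv_cancel_right,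
    (commute_quarter_altProd hq).eq, mul_inv_cancel_right] at h

theorem a₁_mul_a₂_pow_qTilde : (a₁ q hq * a₂ q hq) ^ qTilde q = 1 := by
  rw [a₁_mul_a₂, ← map_pow, ← map_one mu, neg_pow]
  congr 1
  unfold qTilde
  split_ifs with h4 h2
  · rw [← pow_mul, mul_comm 2 q, pow_mul, zetaUnit_pow_self hq, neg_one_sq, mul_one]
    exact Even.neg_one_pow (Nat.even_iff.2 (by omega))
  · rw [← pow_mul, Nat.mul_div_cancel' (by omega), zetaUnit_pow_self hq,
      Odd.neg_one_pow (Nat.odd_iff.2 (by omega)), neg_one_mul, neg_neg]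
  · rw [pow_mul, neg_one_sq, one_pow, one_mul, ← pow_mul, ← mul_assoc, mul_comm, pow_mul,
      zetaUnit_pow_self hq, Even.neg_one_pow (by decide)]

/-- The homomorphism from the presented group to the automorphisms of `ℂ`. -/
def monodromyHom : PresentedGroup (oddRels q) →* (ℂ ≃ₗ[ℝ] ℂ) :=
  PresentedGroup.toGroup (f := ![a₁ q hq, a₂ q hq]) (by
    rintro r (rfl | rfl)
    · rw [map_mul, map_inv, map_altProd, map_altProd, mul_inv_eq_one]
      simpa using altProd_braid hq
    · simpa using a₁_mul_a₂_pow_qTilde hq)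

theorem monodromyHom_zero : monodromyHom hq (PresentedGroup.of 0) = a₁ q hq := by
  rw [monodromyHom, PresentedGroup.toGroup.of]
  rfl

theorem monodromyHom_one : monodromyHom hq (PresentedGroup.of 1) = a₂ q hq := by
  rw [monodromyHom, PresentedGroup.toGroup.of]
  rfl

theorem presented_braid (q : ℕ) :
    altProd (PresentedGroup.of 0 : PresentedGroup (oddRels q)) (PresentedGroup.of 1) q =
      altProd (PresentedGroup.of 1) (PresentedGroup.of 0) q := by
  have h := PresentedGroup.one_of_mem (rels := oddRels q) (Set.mem_insert _ _)
  rw [map_mul, map_inv, map_altProd, map_altProd, mul_inv_eq_one] at h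
  exact h

theorem presented_pow (q : ℕ) :
    ((PresentedGroup.of 0 : PresentedGroup (oddRels q)) * PresentedGroup.of 1) ^ qTilde q = 1 := by
  have h := PresentedGroup.one_of_mem (rels := oddRels q)
    (Set.mem_insert_of_mem _ (Set.mem_singleton _))
  rw [map_pow, map_mul] at h
  exact h

theorem presented_closure (q : ℕ) :
    Subgroup.closure {(PresentedGroup.of 0 : PresentedGroup (oddRels q)), PresentedGroup.of 1} =
      ⊤ := by
  rw [← PresentedGroup.closure_range_of]
  congr 1
  ext x
  simp [Fin.exists_fin_two, eq_comm]

theorem monodromyHom_range : (monodromyHom hq).range = oddMonodromy q hq := by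
  rw [MonoidHom.range_eq_map, ← presented_closure, MonoidHom.map_closure, Set.image_pair,
    monodromyHom_zero, monodromyHom_one, oddMonodromy_eq]

end relations

theorem commute_of_closure_eq_top {G : Type*} [Group G] {a b c : G}
    (h : Subgroup.closure {a, b} = ⊤) (ha : Commute c a) (hb : Commute c b) (p : G) :
    Commute c p := by
  have hle : Subgroup.closure {a, b} ≤ Subgroup.centralizer {c} := by
    rw [Subgroup.closure_le]
    rintro _ (rfl | rfl)
    · exact Subgroup.mem_centralizer_singleton_iff.2 ha.symm.eq
    · exact Subgroup.mem_centralizer_singleton_iff.2 hb.symm.eq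
  have hp : p ∈ Subgroup.closure {a, b} := h ▸ Subgroup.mem_top p
  exact (Subgroup.mem_centralizer_singleton_iff.1 (hle hp)).symm

theorem normal_zpowers_of_commute {G : Type*} [Group G] {c : G} (h : ∀ p, Commute c p) :
    (Subgroup.zpowers c).Normal := by
  refine ⟨?_⟩
  rintro _ ⟨n, rfl⟩ p
  refine ⟨n, ?_⟩
  change c ^ n = p * c ^ n * p⁻¹
  rw [eq_mul_inv_iff_mul_eq]
  exact ((h p).zpow_left n).eq

end

section

variable {q : ℕ}

/-! ### The kernel of the action on lines -/

theorem zpow_mem_zpowers_of_dvd {G : Type*} [Group G] {a c : G} {k : ℕ} (h : a ^ k = c) {n : ℤ}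
    (hn : (k : ℤ) ∣ n) : a ^ n ∈ Subgroup.zpowers c := by
  obtain ⟨m, rfl⟩ := hn
  exact ⟨m, by simp [zpow_mul, h]⟩

theorem isSign_map_of_mem_zpowers {P : Type*} [Group P] {f : P →* (ℂ ≃ₗ[ℝ] ℂ)} {c : P} {j : ℤ}
    (h : f c = mu (-1) ^ j) : ∀ p ∈ Subgroup.zpowers c, IsSign (f p) := by
  rintro _ ⟨n, rfl⟩
  change IsSign (f (c ^ n))
  rw [map_zpow, h, ← zpow_mul]
  exact isSign_mu_neg_one_zpow _

section kernel

variable (hq : 3 ≤ q)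

theorem monodromyHom_mul : monodromyHom hq (PresentedGroup.of 0 * PresentedGroup.of 1) =
    mu (-zetaUnit q ^ 2) := by
  rw [map_mul, monodromyHom_zero, monodromyHom_one, a₁_mul_a₂]

theorem monodromyHom_mul_zpow_apply (n : ℤ) (z : ℂ) :
    monodromyHom hq ((PresentedGroup.of 0 * PresentedGroup.of 1) ^ n) z =
      ((-1) ^ n : ℝ) • (zeta q ^ (2 * n) * z) := by
  rw [map_zpow, monodromyHom_mul, ← map_zpow, mu_neg_zeta_sq_zpow_apply]

/-- For `q = 2k + 1` the elements `D = (xy)ᵏ x` and `xy` play ping-pong on the lines of `ℂ`: they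
act on lines as the quarter turn and as a rotation of order `q`, and `D² = (xy)^q` is central. -/
theorem monodromyHom_isSign_mem_of_odd {k : ℕ} (hk : q = 2 * k + 1) :
    ∃ c : PresentedGroup (oddRels q), c ^ 2 = 1 ∧ monodromyHom hq c = mu (-1) ∧
      ∀ p, IsSign (monodromyHom hq p) → p ∈ Subgroup.zpowers c := by
  set x : PresentedGroup (oddRels q) := PresentedGroup.of 0 with hx
  set y : PresentedGroup (oddRels q) := PresentedGroup.of 1 with hy
  have hbraid : (x * y) ^ k * x = (y * x) ^ k * y := by
    have := presented_braid q
    rwa [hk, altProd_two_mul_add_one, altProd_two_mul_add_one, ← hk] at this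
  obtain ⟨hsq, hxy, hyx⟩ := braid_odd hbraid
  rw [← hk] at hsq
  set D := (x * y) ^ k * x with hD
  have hgen := presented_closure q
  rw [← hx, ← hy] at hgen
  have hcomm : ∀ p, Commute ((x * y) ^ q) p := by
    rw [← hsq]
    refine commute_of_closure_eq_top hgen ?_ ?_
    · rw [Commute, SemiconjBy, pow_two, mul_assoc, hyx, ← mul_assoc, hxy, mul_assoc]
    · rw [Commute, SemiconjBy, pow_two, mul_assoc, hxy, ← mul_assoc, hyx, mul_assoc]
  have hfD : monodromyHom hq D = mu (-1) ^ (k + 1) * (quarter q hq)⁻¹ := by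
    rw [hD, map_mul, map_pow, map_mul, hx, hy, monodromyHom_zero, monodromyHom_one,
      a₁_mul_a₂_pow_of_odd hq hk]
  have hfc : monodromyHom hq ((x * y) ^ q) = mu (-1) := by
    rw [map_pow, monodromyHom_mul, ← map_pow, neg_pow, ← pow_mul, mul_comm 2 q, pow_mul,
      zetaUnit_pow_self hq, neg_one_sq, mul_one, Odd.neg_one_pow ⟨k, hk⟩]
  have hC := isSign_map_of_mem_zpowers (j := 1) (by rw [hfc, zpow_one])
  refine ⟨(x * y) ^ q, ?_, hfc, ?_⟩
  · have := presented_pow q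
    rwa [qTilde, if_neg (by omega), if_neg (by omega), mul_comm, pow_mul] at this
  have := normal_zpowers_of_commute hcomm
  refine mem_of_isSign_of_quadratic (monodromyHom hq) (Subgroup.zpowers ((x * y) ^ q)) hC
    (fun z => height q 1 z * height q 0 z) ?_ ?_ ?_ D (x * y) ?_ ?_ ?_ ?_
  · intro r z
    simp only [height_smul]
    ring
  · refine ⟨psi q hq ![1, -1], ?_⟩
    rw [height_one_psi, height_zero_psi]
    simpa using (im_zeta_pos hq).ne'
  · refine ⟨psi q hq ![1, 1], ?_⟩
    rw [height_one_psi, height_zero_psi]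
    simpa using (im_zeta_pos hq).ne'
  · have hDmem : D ∈ Subgroup.closure {D, x * y} := Subgroup.subset_closure (by simp)
    have hbmem : x * y ∈ Subgroup.closure {D, x * y} := Subgroup.subset_closure (by simp)
    have hxmem : x ∈ Subgroup.closure {D, x * y} := by
      have h := mul_mem (inv_mem (pow_mem hbmem k)) hDmem
      rwa [hD, inv_mul_cancel_left, ← hD] at h
    have hymem : y ∈ Subgroup.closure {D, x * y} := by
      have h := mul_mem (inv_mem hxmem) hbmem
      rwa [inv_mul_cancel_left] at h
    rw [eq_top_iff, ← hgen, Subgroup.closure_le]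
    rintro _ (rfl | rfl)
    · exact hxmem
    · exact hymem
  · intro n hn z hz
    -- Only odd powers of `D` lie outside the central subgroup, and they act as the quarter turn.
    rcases Int.even_or_odd' n with ⟨m, rfl | rfl⟩
    · exact (hn (zpow_mem_zpowers_of_dvd hsq ⟨m, rfl⟩)).elim
    · have hsign : IsSign (mu (-1) ^ (m + (k + 1 : ℕ))) := isSign_mu_neg_one_zpow _
      have h : monodromyHom hq (D ^ (2 * m + 1)) =
          mu (-1) ^ (m + (k + 1 : ℕ)) * (quarter q hq)⁻¹ := by
        rw [zpow_add_one, zpow_mul, zpow_ofNat, hsq, map_mul, map_zpow, hfc, hfD, zpow_add,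
          zpow_natCast, mul_assoc]
      have hv : z = quarter q hq ((quarter q hq)⁻¹ z) := by
        rw [← LinearEquiv.mul_apply, mul_inv_cancel]
        rfl
      rw [hv, height_one_quarter, height_zero_quarter] at hz
      rw [h, LinearEquiv.mul_apply, height_pair_of_isSign hsign]
      linarith
  · intro n hn z hz
    -- `(xy)ⁿ` acts as the rotation by `2nπ/q`, and `2` is invertible modulo `q`.
    have hdvd : ¬ (q : ℤ) ∣ 2 * n := by
      intro h
      refine hn (zpow_mem_zpowers_of_dvd rfl ?_)
      refine IsCoprime.dvd_of_dvd_mul_left ?_ h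
      exact ⟨1, -k, by rw [hk]; push_cast; ring⟩
    have := height_adjacent_pos hq hdvd hz
    rw [monodromyHom_mul_zpow_apply, height_smul, height_smul, height_zpow_mul, height_zpow_mul,
      mul_mul_mul_comm, ← mul_zpow]
    simpa using this
  · have key : ∀ j : ℕ, ¬ q ∣ 2 * j → (x * y) ^ j ∉ Subgroup.zpowers ((x * y) ^ q) := by
      intro j hj hmem
      have h := hC _ hmem
      rw [map_pow, monodromyHom_mul, ← map_pow] at h
      have h1 := congrArg Units.val h.mu_sq_eq_one
      rw [← pow_mul, neg_pow, mul_comm j 2, pow_mul (-1 : ℂˣ), neg_one_sq, one_pow, one_mul,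
        ← pow_mul, Units.val_pow_eq_pow_val] at h1
      have h2 := (isPrimitiveRoot_zeta hq).dvd_of_pow_eq_one _ h1
      exact hj (Nat.dvd_of_mul_dvd_mul_left two_pos h2)
    right
    refine ⟨?_, key 2 ?_⟩
    · rw [← pow_one (x * y)]
      refine key 1 ?_
      intro h
      exact absurd (Nat.le_of_dvd two_pos h) (by omega)
    · intro h
      have h4 := Nat.le_of_dvd (by norm_num) h
      obtain rfl : q = 3 := by omega
      norm_num at h

/-- For `q = 2k` the elements `x` and `xy` play ping-pong on the lines of `ℂ`: they act on
lines as a transvection and as a rotation of order `k`, and `(xy)ᵏ` is central. -/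
theorem monodromyHom_isSign_mem_of_even {k : ℕ} (hk : q = 2 * k) :
    ∃ c : PresentedGroup (oddRels q), c ^ 2 = 1 ∧ (q % 4 = 0 → monodromyHom hq c = mu (-1)) ∧
      (q % 4 = 2 → c = 1) ∧ ∀ p, IsSign (monodromyHom hq p) → p ∈ Subgroup.zpowers c := by
  set x : PresentedGroup (oddRels q) := PresentedGroup.of 0 with hx
  set y : PresentedGroup (oddRels q) := PresentedGroup.of 1 with hy
  have hbraid : (x * y) ^ k = (y * x) ^ k := by
    have := presented_braid q
    rwa [hk, altProd_two_mul, altProd_two_mul, ← hk] at this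
  have hgen := presented_closure q
  rw [← hx, ← hy] at hgen
  have hgen' : Subgroup.closure {x, x * y} = ⊤ := by
    have hxmem : x ∈ Subgroup.closure {x, x * y} := Subgroup.subset_closure (by simp)
    have hbmem : x * y ∈ Subgroup.closure {x, x * y} := Subgroup.subset_closure (by simp)
    have hymem : y ∈ Subgroup.closure {x, x * y} := by
      have h := mul_mem (inv_mem hxmem) hbmem
      rwa [inv_mul_cancel_left] at h
    rw [eq_top_iff, ← hgen, Subgroup.closure_le]
    rintro _ (rfl | rfl)
    · exact hxmem
    · exact hymem
  have hcomm : ∀ p, Commute ((x * y) ^ k) p := by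
    refine commute_of_closure_eq_top hgen' ?_ ((Commute.refl _).pow_left k)
    have : SemiconjBy x (y * x) (x * y) := by simp [SemiconjBy, mul_assoc]
    have h2 := this.pow_right k
    rw [← hbraid] at h2
    exact h2.symm
  have hfc : monodromyHom hq ((x * y) ^ k) = mu (-1) ^ (k + 1) := by
    rw [map_pow, map_mul, hx, hy, monodromyHom_zero, monodromyHom_one,
      a₁_mul_a₂_pow_of_even hq hk]
  have hC := isSign_map_of_mem_zpowers (j := (k + 1 : ℕ)) (by rw [hfc, zpow_natCast])
  have h2 : q % 4 = 2 → (x * y) ^ k = 1 := by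
    intro h
    have := presented_pow q
    rwa [qTilde, if_neg (by omega), if_pos h, show q / 2 = k by omega] at this
  refine ⟨(x * y) ^ k, ?_, ?_, h2, ?_⟩
  · rcases (by omega : q % 4 = 0 ∨ q % 4 = 2) with h | h
    · have := presented_pow q
      rwa [qTilde, if_pos h, show q = k * 2 by omega, pow_mul, show k * 2 = q by omega] at this
    · rw [h2 h, one_pow]
  · intro h
    rw [hfc, ← map_pow, Odd.neg_one_pow (Nat.odd_iff.2 (by omega))]
  have := normal_zpowers_of_commute hcomm
  refine mem_of_isSign_of_quadratic (monodromyHom hq) (Subgroup.zpowers ((x * y) ^ k)) hC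
    (fun z => height q 1 z * height q (-1) z) ?_ ?_ ?_ x (x * y) hgen' ?_ ?_ ?_
  · intro r z
    simp only [height_smul]
    ring
  · refine ⟨psi q hq ![1, 0], ?_⟩
    rw [height_neg_one hq, height_one_psi, height_zero_psi]
    simpa using (im_zeta_pos hq).ne'
  · refine ⟨psi q hq ![lam q, 2], ?_⟩
    rw [height_neg_one hq, height_one_psi, height_zero_psi]
    have h1 := mul_pos (im_zeta_pos hq) (lam_pos hq)
    simp only [Matrix.cons_val_zero, Matrix.cons_val_one]
    nlinarith
  · intro n hn z hz
    have hn0 : n ≠ 0 := by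
      rintro rfl
      exact hn (by simp)
    obtain ⟨h0, h1⟩ := height_a₁_pow hq n z
    rw [map_zpow, hx, monodromyHom_zero, height_neg_one hq, h0, h1]
    rw [height_neg_one hq] at hz
    generalize height q 1 z = s at *
    generalize lam q * height q 0 z = t at *
    rcases lt_or_gt_of_ne hn0 with h | h
    · have hn1 : (n : ℝ) ≤ -1 := by exact_mod_cast Int.le_sub_one_of_lt h
      nlinarith [mul_nonneg (by linarith : (0 : ℝ) ≤ -1 - n) (sq_nonneg t), sq_nonneg (s - t)]
    · have hn1 : (1 : ℝ) ≤ n := by exact_mod_cast h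
      have hst : 0 ≤ s * t := by nlinarith [sq_nonneg s]
      nlinarith [mul_nonneg (by linarith : (0 : ℝ) ≤ n - 1) hst, sq_nonneg s,
        mul_nonneg (mul_nonneg (by linarith : (0 : ℝ) ≤ n) (by linarith : (0 : ℝ) ≤ n - 1))
          (sq_nonneg t)]
  · intro n hn z hz
    -- `(xy)ⁿ` acts as the rotation by `2nπ/q`, and `2n` modulo `q` is even and nonzero.
    have hk0 : (0 : ℤ) < k := by omega
    have hmod : 2 * n % (q : ℤ) = 2 * (n % k) := by
      rw [hk, Nat.cast_mul, Nat.cast_two, Int.mul_emod_mul_of_pos _ _ two_pos]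
    have h0 := Int.emod_nonneg n hk0.ne'
    have h1 := Int.emod_lt_of_pos n hk0
    have hne : n % k ≠ 0 := fun h => hn (zpow_mem_zpowers_of_dvd rfl (Int.dvd_of_emod_eq_zero h))
    have := height_gap_pos hq (m := 2 * n) (by omega) (by omega) hz
    rw [monodromyHom_mul_zpow_apply, height_smul, height_smul, height_zpow_mul, height_zpow_mul,
      mul_mul_mul_comm, ← mul_zpow]
    simpa using this
  · have key : ∀ j : ℕ, j ≠ 0 → x ^ j ∉ Subgroup.zpowers ((x * y) ^ k) := by
      intro j hj hmem
      have h := hC _ hmem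
      rw [map_pow, hx, monodromyHom_zero, ← zpow_natCast] at h
      exact not_isSign_a₁_zpow hq (by exact_mod_cast hj) h
    left
    exact ⟨by simpa using key 1 one_ne_zero, key 2 two_ne_zero⟩

theorem monodromyHom_injective : Function.Injective (monodromyHom hq) := by
  have key : ∀ c : PresentedGroup (oddRels q), c ^ 2 = 1 → (monodromyHom hq c = 1 → c = 1) →
      (∀ p, IsSign (monodromyHom hq p) → p ∈ Subgroup.zpowers c) →
      Function.Injective (monodromyHom hq) := by
    intro c hc2 hc h
    refine (injective_iff_map_eq_one _).2 fun p hp => ?_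
    obtain ⟨n, hn⟩ := h p (by rw [hp]; exact Or.inl fun z => rfl)
    change c ^ n = p at hn
    rcases Int.even_or_odd' n with ⟨m, rfl | rfl⟩
    · rw [← hn, zpow_mul, zpow_ofNat, hc2, one_zpow]
    · rw [zpow_add_one, zpow_mul, zpow_ofNat, hc2, one_zpow, one_mul] at hn
      rw [← hn] at hp ⊢
      exact hc hp
  rcases Nat.even_or_odd' q with ⟨k, hk | hk⟩
  · obtain ⟨c, hc2, h0, h2, h⟩ := monodromyHom_isSign_mem_of_even hq hk
    refine key c hc2 (fun hc => ?_) h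
    rcases (by omega : q % 4 = 0 ∨ q % 4 = 2) with hm | hm
    · exact absurd ((h0 hm).symm.trans hc) mu_neg_one_ne_one
    · exact h2 hm
  · obtain ⟨c, hc2, h0, h⟩ := monodromyHom_isSign_mem_of_odd hq hk
    exact key c hc2 (fun hc => absurd (h0.symm.trans hc) mu_neg_one_ne_one) h

/-- The presented group is the odd monodromy group. -/
def monodromyEquiv : oddMonodromy q hq ≃* PresentedGroup (oddRels q) :=
  ((MonoidHom.ofInjective (monodromyHom_injective hq)).trans
    (MulEquiv.subgroupCongr (monodromyHom_range hq))).symm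

theorem monodromyEquiv_eq {g : ℂ ≃ₗ[ℝ] ℂ} (hg : g ∈ oddMonodromy q hq)
    {p : PresentedGroup (oddRels q)} (h : monodromyHom hq p = g) :
    monodromyEquiv hq ⟨g, hg⟩ = p := by
  rw [monodromyEquiv, MulEquiv.symm_apply_eq]
  exact Subtype.ext h.symm

theorem mu_neg_one_mem_of_not_two (h : q % 4 ≠ 2) : mu (-1) ∈ oddMonodromy q hq := by
  rw [← monodromyHom_range]
  rcases Nat.even_or_odd' q with ⟨k, hk | hk⟩
  · obtain ⟨c, -, h0, -, -⟩ := monodromyHom_isSign_mem_of_even hq hk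
    exact ⟨c, h0 (by omega)⟩
  · obtain ⟨c, -, h0, -⟩ := monodromyHom_isSign_mem_of_odd hq hk
    exact ⟨c, h0⟩

theorem mu_neg_one_notMem_of_two (h : q % 4 = 2) : mu (-1) ∉ oddMonodromy q hq := by
  rw [← monodromyHom_range]
  rintro ⟨p, hp⟩
  obtain ⟨c, -, -, h2, hmem⟩ := monodromyHom_isSign_mem_of_even hq (k := q / 2) (by omega)
  have := hmem p (by rw [hp]; exact Or.inr mu_neg_one_apply)
  rw [h2 h, Subgroup.zpowers_one_eq_bot, Subgroup.mem_bot] at this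
  rw [this, map_one] at hp
  exact mu_neg_one_ne_one hp.symm

/-- For even `q` the relations are homogeneous in `x` and `y⁻¹`, so `x ↦ 1`, `y ↦ -1` defines a
homomorphism to `ℤ`. It separates the conjugacy classes of `a₁` and `a₂`. -/
theorem conj_a₁_ne_a₂_of_even (h : q % 2 = 0) {g : ℂ ≃ₗ[ℝ] ℂ} (hg : g ∈ oddMonodromy q hq) :
    g * a₁ q hq ≠ a₂ q hq * g := by
  intro heq
  rw [← monodromyHom_range] at hg
  obtain ⟨p, rfl⟩ := hg
  rw [← monodromyHom_zero, ← monodromyHom_one, ← map_mul, ← map_mul] at heq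
  have hp := monodromyHom_injective hq heq
  obtain ⟨k, hk⟩ : ∃ k, q = 2 * k := ⟨q / 2, by omega⟩
  let χ : PresentedGroup (oddRels q) →* Multiplicative ℤ :=
    PresentedGroup.toGroup (f := ![Multiplicative.ofAdd 1, Multiplicative.ofAdd (-1)]) (by
      rintro r (rfl | rfl)
      · rw [map_mul, map_inv, map_altProd, map_altProd, mul_inv_eq_one, hk, altProd_two_mul,
          altProd_two_mul, mul_comm]
      · simp)
  have h0 : χ (PresentedGroup.of 0) = Multiplicative.ofAdd 1 := PresentedGroup.toGroup.of _
  have h1 : χ (PresentedGroup.of 1) = Multiplicative.ofAdd (-1) := PresentedGroup.toGroup.of _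
  have := congrArg χ hp
  rw [map_mul, map_mul, mul_comm, mul_left_inj, h0, h1] at this
  exact absurd (Multiplicative.ofAdd.injective this) (by norm_num)

end kernel

end

section

variable {q : ℕ} (hq : 3 ≤ q)

/-! ### The stabilizer of `1` in the Hecke group -/

/-- The monoid generated by the elements `uʲ v⁻¹` with `0 < j < q`, where `u` is multiplication by
`ζ` and `v` is the quarter turn. In the basis `1`, `ζ^(q-1)` its generators have nonnegative
entries and positive diagonal. -/
def positiveMonoid : Submonoid (ℂ ≃ₗ[ℝ] ℂ) :=
  Submonoid.closure {g | ∃ j : ℕ, 0 < j ∧ j < q ∧ g = mu (zetaUnit q) ^ j * (quarter q hq)⁻¹}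

theorem mu_zetaUnit_pow_self (hq : 3 ≤ q) : mu (zetaUnit q) ^ q = mu (-1) := by
  rw [← map_pow, zetaUnit_pow_self hq]

theorem mu_neg_one_zpow_eq (n : ℤ) : mu (-1) ^ n = 1 ∨ mu (-1) ^ n = mu (-1) := by
  rw [← map_zpow]
  rcases Int.even_or_odd n with h | h
  · exact Or.inl (by rw [h.neg_one_zpow, map_one])
  · exact Or.inr (by rw [h.neg_one_zpow])

theorem quarter_zpow_two_mul (n : ℤ) : quarter q hq ^ (2 * n) = mu (-1) ^ n := by
  rw [zpow_mul, zpow_ofNat, quarter_sq]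

theorem commute_mu_neg_one_zpow (n : ℤ) (g : ℂ ≃ₗ[ℝ] ℂ) : Commute (mu (-1) ^ n) g :=
  (commute_mu_neg_one g).zpow_left n

/-- Left multiplication by `u` or by `v` preserves the shape `vᵃ M vᶜ` with `M` in the positive
monoid, because `u (uʲ v⁻¹) = uʲ⁺¹ v⁻¹` and `u^q v⁻¹ = v`. -/
theorem exists_eq_of_mem_heckeC {g : ℂ ≃ₗ[ℝ] ℂ} (hg : g ∈ heckeC q hq) :
    ∃ a c : ℤ, ∃ M ∈ positiveMonoid hq, g = quarter q hq ^ a * M * quarter q hq ^ c := by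
  set v := quarter q hq with hv
  set u := mu (zetaUnit q) with hu
  let S : Set (ℂ ≃ₗ[ℝ] ℂ) := {g | ∃ a c : ℤ, ∃ M ∈ positiveMonoid hq, g = v ^ a * M * v ^ c}
  have hSv : ∀ (n : ℤ), ∀ g ∈ S, v ^ n * g ∈ S := by
    rintro n _ ⟨a, c, M, hM, rfl⟩
    exact ⟨n + a, c, M, hM, by simp only [zpow_add, mul_assoc]⟩
  have hgen : ∀ j : ℕ, 0 < j → j < q → u ^ j * v⁻¹ ∈ positiveMonoid hq := fun j h0 h1 =>
    Submonoid.subset_closure ⟨j, h0, h1, rfl⟩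
  have hSuM : ∀ M ∈ positiveMonoid hq, ∀ c : ℤ, u * (M * v ^ c) ∈ S := by
    intro M hM c
    induction hM using Submonoid.closure_induction_left with
    | one =>
      refine ⟨0, c + 1, u ^ 1 * v⁻¹, hgen 1 one_pos (by omega), ?_⟩
      rw [add_comm c, zpow_one_add, pow_one, zpow_zero, one_mul, one_mul, mul_assoc u,
        inv_mul_cancel_left]
    | mul_left x hx M hM ih =>
      obtain ⟨j, h0, h1, rfl⟩ := hx
      rcases (by omega : j + 1 < q ∨ j + 1 = q) with h | h
      · refine ⟨0, c, u ^ (j + 1) * v⁻¹ * M, mul_mem (hgen _ (by omega) h) hM, ?_⟩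
        simp only [pow_succ', zpow_zero, one_mul, mul_assoc]
        rfl
      · refine ⟨1, c, M, hM, ?_⟩
        have : u * (u ^ j * v⁻¹) = v := by
          rw [← mul_assoc, ← pow_succ', h, mu_zetaUnit_pow_self hq, ← quarter_sq hq, pow_two,
            mul_inv_cancel_right]
        calc u * (u ^ j * v⁻¹ * M * v ^ c) = u * (u ^ j * v⁻¹) * M * v ^ c := by
              simp only [mul_assoc]
          _ = v ^ (1 : ℤ) * M * v ^ c := by rw [this, zpow_one]
  have hSu : ∀ g ∈ S, u * g ∈ S := by
    rintro _ ⟨a, c, M, hM, rfl⟩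
    rcases Int.even_or_odd' a with ⟨b, rfl | rfl⟩
    · have := hSv (2 * b) _ (hSuM M hM c)
      rw [quarter_zpow_two_mul, ← mul_assoc, (commute_mu_neg_one_zpow b u).eq] at this
      rw [quarter_zpow_two_mul]
      simpa only [mul_assoc] using this
    · refine ⟨2 * (b + 1), c, u ^ 1 * v⁻¹ * M, mul_mem (hgen 1 one_pos (by omega)) hM, ?_⟩
      have h1 : v ^ (2 * b + 1) = mu (-1) ^ (b + 1) * v⁻¹ := by
        rw [← quarter_zpow_two_mul hq, ← zpow_sub_one]
        congr 1
        ring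
      rw [h1, quarter_zpow_two_mul, pow_one]
      calc u * (mu (-1) ^ (b + 1) * v⁻¹ * M * v ^ c)
          = (u * mu (-1) ^ (b + 1)) * (v⁻¹ * M * v ^ c) := by simp only [mul_assoc]
        _ = mu (-1) ^ (b + 1) * (u * v⁻¹ * M) * v ^ c := by
            rw [← (commute_mu_neg_one_zpow (b + 1) u).eq]
            simp only [mul_assoc]
  have hSun : ∀ (n : ℕ), ∀ g ∈ S, u ^ n * g ∈ S := by
    intro n g hg
    induction n with
    | zero => simpa using hg
    | succ n ih =>
      rw [pow_succ', mul_assoc]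
      exact hSu _ ih
  have hui : u⁻¹ = u ^ (2 * q - 1) := by
    rw [inv_eq_iff_mul_eq_one, ← pow_succ', show 2 * q - 1 + 1 = q * 2 by omega, pow_mul,
      mu_zetaUnit_pow_self hq, mu_neg_one_sq]
  have ha : a₁ q hq = u * v⁻¹ := by rw [hu, ← a₁_mul_quarter hq, mul_inv_cancel_right]
  rw [heckeC_eq] at hg
  change g ∈ S
  induction hg using Subgroup.closure_induction_left with
  | one => exact ⟨0, 0, 1, one_mem _, by simp⟩
  | mul_left x hx y hy ih =>
    rcases hx with rfl | rfl
    · simpa using hSv 1 _ ih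
    · rw [ha, mul_assoc]
      simpa using hSu _ (hSv (-1) _ ih)
  | inv_mul_cancel x hx y hy ih =>
    rcases hx with rfl | rfl
    · simpa using hSv (-1) _ ih
    · rw [ha, mul_inv_rev, inv_inv, hui, mul_assoc]
      simpa using hSv 1 _ (hSun _ _ ih)

theorem a₂_eq_mul : a₂ q hq = mu (-1) * (quarter q hq * mu (zetaUnit q)) := by
  rw [a₂_eq, quarter_inv, ← a₁_mul_quarter hq, ← mul_assoc,
    ← (commute_mu_neg_one (quarter q hq * a₁ q hq)).eq]
  simp only [mul_assoc]

theorem height_mu_zetaUnit_pow (n : ℤ) (j : ℕ) (z : ℂ) :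
    height q n ((mu (zetaUnit q) ^ j) z) = height q (n + j) z := by
  rw [← map_pow, mu_apply, ← height_zpow_mul, zpow_natCast]
  rfl

theorem height_quarter_inv (n : ℤ) (z : ℂ) : height q n ((quarter q hq)⁻¹ z) * (zeta q).im =
    (zeta q ^ n).im * height q 0 z + (zeta q ^ (n - 1)).im * height q 1 z := by
  obtain ⟨w, rfl⟩ := (quarter q hq).surjective z
  have hw : (quarter q hq)⁻¹ (quarter q hq w) = w := by
    rw [← LinearEquiv.mul_apply, inv_mul_cancel]
    rfl
  have := height_mul_im hq n 0 1 w
  rw [hw, height_zero_quarter, height_one_quarter]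
  simp only [sub_zero, zpow_one] at this
  rw [this]
  ring

theorem height_one_one : height q 1 1 = (zeta q).im := by simp [height]

theorem height_zero_one : height q 0 1 = 0 := by simp [height]

/-- The entries of an element of the positive monoid: the diagonal ones are positive, the others
nonnegative, and if one of the latter vanishes then the element is a power of `a₁` or `a₂`. -/
theorem positiveMonoid_heights {M : ℂ ≃ₗ[ℝ] ℂ} (hM : M ∈ positiveMonoid hq) :
    (0 ≤ height q 0 (M 1) ∧ 0 < height q 1 (M 1) ∧
      (height q 0 (M 1) = 0 → M ∈ Subgroup.zpowers (a₁ q hq))) ∧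
    (0 < height q 0 (M (quarter q hq 1)) ∧ 0 ≤ height q 1 (M (quarter q hq 1)) ∧
      (height q 1 (M (quarter q hq 1)) = 0 → M ∈ Subgroup.zpowers (a₂ q hq))) := by
  have hs := im_zeta_pos hq
  induction hM using Submonoid.closure_induction_left with
  | one =>
    change (0 ≤ height q 0 1 ∧ 0 < height q 1 1 ∧ _) ∧
      0 < height q 0 (quarter q hq 1) ∧ 0 ≤ height q 1 (quarter q hq 1) ∧ _
    rw [height_zero_quarter, height_one_quarter, height_one_one, height_zero_one, neg_zero]
    exact ⟨⟨le_rfl, hs, fun _ => one_mem _⟩, hs, le_rfl, fun _ => one_mem _⟩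
  | mul_left x hx M hM ih =>
    obtain ⟨j, hj0, hj1, rfl⟩ := hx
    have hz : ∀ z, height q 0 ((mu (zetaUnit q) ^ j * (quarter q hq)⁻¹ * M) z) * (zeta q).im =
        (zeta q ^ (j : ℤ)).im * height q 0 (M z) +
          (zeta q ^ (j - 1 : ℤ)).im * height q 1 (M z) := by
      intro z
      rw [LinearEquiv.mul_apply, LinearEquiv.mul_apply, height_mu_zetaUnit_pow,
        height_quarter_inv, zero_add]
    have ho : ∀ z, height q 1 ((mu (zetaUnit q) ^ j * (quarter q hq)⁻¹ * M) z) * (zeta q).im =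
        (zeta q ^ (j + 1 : ℤ)).im * height q 0 (M z) +
          (zeta q ^ (j : ℤ)).im * height q 1 (M z) := by
      intro z
      rw [LinearEquiv.mul_apply, LinearEquiv.mul_apply, height_mu_zetaUnit_pow,
        height_quarter_inv, add_sub_cancel_left, add_comm (1 : ℤ)]
    have p0 : 0 < (zeta q ^ (j : ℤ)).im := zeta_zpow_im_pos hq (by omega) (by omega)
    have pm : 0 ≤ (zeta q ^ (j - 1 : ℤ)).im := zeta_zpow_im_nonneg hq (by omega) (by omega)
    have pp : 0 ≤ (zeta q ^ (j + 1 : ℤ)).im := zeta_zpow_im_nonneg hq (by omega) (by omega)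
    obtain ⟨⟨h1, h2, h3⟩, h4, h5, h6⟩ := ih
    refine ⟨⟨nonneg_of_mul_nonneg_left ?_ hs, pos_of_mul_pos_left ?_ hs.le, ?_⟩,
      pos_of_mul_pos_left ?_ hs.le, nonneg_of_mul_nonneg_left ?_ hs, ?_⟩
    · rw [hz]; positivity
    · rw [ho]; positivity
    · intro h
      have e := hz 1
      rw [h, zero_mul] at e
      have e1 : (zeta q ^ (j : ℤ)).im * height q 0 (M 1) = 0 := by
        nlinarith [mul_nonneg p0.le h1, mul_nonneg pm h2.le]
      have e2 : (zeta q ^ (j - 1 : ℤ)).im * height q 1 (M 1) = 0 := by linarith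
      have hj : j = 1 := by
        by_contra hne
        have := zeta_zpow_im_pos hq (n := j - 1) (by omega) (by omega)
        exact (mul_pos this h2).ne' e2
      subst hj
      rw [pow_one, ← a₁_mul_quarter hq, mul_inv_cancel_right]
      exact mul_mem (Subgroup.mem_zpowers _) (h3 ((mul_eq_zero.1 e1).resolve_left p0.ne'))
    · rw [hz]; positivity
    · rw [ho]; positivity
    · intro h
      have e := ho (quarter q hq 1)
      rw [h, zero_mul] at e
      have e1 : (zeta q ^ (j : ℤ)).im * height q 1 (M (quarter q hq 1)) = 0 := by
        nlinarith [mul_nonneg p0.le h5, mul_nonneg pp h4.le]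
      have e2 : (zeta q ^ (j + 1 : ℤ)).im * height q 0 (M (quarter q hq 1)) = 0 := by linarith
      have hj : j + 1 = q := by
        by_contra hne
        have := zeta_zpow_im_pos hq (n := j + 1) (by omega) (by omega)
        exact (mul_pos this h4).ne' e2
      have hinv : mu (zetaUnit q) ^ j * (quarter q hq)⁻¹ = (a₂ q hq)⁻¹ := by
        rw [eq_inv_iff_mul_eq_one, a₂_eq_mul, (commute_mu_neg_one _).eq, mul_assoc _ _ (_ * _),
          ← mul_assoc (quarter q hq)⁻¹, ← mul_assoc (quarter q hq)⁻¹, inv_mul_cancel, one_mul,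
          ← mul_assoc, ← pow_succ, hj, mu_zetaUnit_pow_self hq, ← pow_two, mu_neg_one_sq]
      rw [hinv]
      exact mul_mem (inv_mem (Subgroup.mem_zpowers _))
        (h6 ((mul_eq_zero.1 e1).resolve_left p0.ne'))

/-- The stabilizer of `1` in the Hecke group is generated by `a₁`: an element `vᵃ M vᶜ` fixing `1`
forces an off-diagonal entry of `M` to vanish. -/
theorem mem_zpowers_a₁_of_apply_one {g : ℂ ≃ₗ[ℝ] ℂ} (hg : g ∈ heckeC q hq) (h1 : g 1 = 1) :
    g ∈ Subgroup.zpowers (a₁ q hq) := by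
  have hs := im_zeta_pos hq
  obtain ⟨a, c, M, hM, rfl⟩ := exists_eq_of_mem_heckeC hq hg
  obtain ⟨⟨p1, p2, p3⟩, p4, p5, p6⟩ := positiveMonoid_heights hq hM
  set v := quarter q hq with hv
  have hsplit : ∀ n : ℤ, ∃ e : ℤ, v ^ n = mu (-1) ^ e ∨ v ^ n = mu (-1) ^ e * v := by
    intro n
    rcases Int.even_or_odd' n with ⟨b, rfl | rfl⟩
    · exact ⟨b, Or.inl (quarter_zpow_two_mul hq b)⟩
    · exact ⟨b, Or.inr (by rw [zpow_add_one, quarter_zpow_two_mul hq b])⟩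
  have hsign : ∀ (e : ℤ) (h : ℂ ≃ₗ[ℝ] ℂ), (mu (-1) ^ e * h) 1 = 1 →
      h 1 = 1 ∧ mu (-1) ^ e = 1 ∨ h 1 = -1 ∧ mu (-1) ^ e = mu (-1) := by
    intro e h he
    rcases mu_neg_one_zpow_eq e with h' | h'
    · rw [h', one_mul] at he
      exact Or.inl ⟨he, h'⟩
    · rw [h', LinearEquiv.mul_apply, mu_neg_one_apply] at he
      exact Or.inr ⟨neg_eq_iff_eq_neg.1 he, h'⟩
  have hzero : ∀ z : ℂ, z = 1 ∨ z = -1 → height q 0 z = 0 := by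
    rintro z (rfl | rfl)
    · exact height_zero_one
    · rw [height_neg, height_zero_one, neg_zero]
  have hsign0 : ∀ (e : ℤ) (h : ℂ ≃ₗ[ℝ] ℂ), (mu (-1) ^ e * h) 1 = 1 → height q 0 (h 1) = 0 := by
    intro e h he
    exact hzero _ ((hsign e h he).imp And.left And.left)
  obtain ⟨e, he⟩ := hsplit a
  obtain ⟨d, hd⟩ := hsplit c
  have hcomm := fun g => (commute_mu_neg_one_zpow d g).eq
  rcases he with he | he <;> rcases hd with hd | hd <;> rw [he, hd] at h1 ⊢
  · have hg : mu (-1) ^ e * M * mu (-1) ^ d = mu (-1) ^ (e + d) * M := by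
      rw [mul_assoc, ← hcomm, ← mul_assoc, zpow_add]
    rw [hg] at h1 ⊢
    rcases hsign _ _ h1 with ⟨h, h'⟩ | ⟨h, -⟩
    · rw [h', one_mul]
      exact p3 (hzero _ (Or.inl h))
    · rw [h, height_neg, height_one_one] at p2
      linarith
  · have hg : mu (-1) ^ e * M * (mu (-1) ^ d * v) = mu (-1) ^ (e + d) * (M * v) := by
      rw [mul_assoc, ← mul_assoc M, ← hcomm, zpow_add]
      simp only [mul_assoc]
    rw [hg] at h1
    exact absurd (hsign0 _ _ h1) p4.ne'
  · have hg : mu (-1) ^ e * v * M * mu (-1) ^ d = mu (-1) ^ (e + d) * (v * M) := by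
      rw [← hcomm, add_comm, zpow_add]
      simp only [mul_assoc]
    rw [hg] at h1
    have := hsign0 _ _ h1
    rw [LinearEquiv.mul_apply, height_zero_quarter] at this
    exact absurd this p2.ne'
  · have hg : mu (-1) ^ e * v * M * (mu (-1) ^ d * v) = mu (-1) ^ (e + d) * (v * M * v) := by
      rw [← mul_assoc _ _ v, ← hcomm, add_comm, zpow_add]
      simp only [mul_assoc]
    rw [hg] at h1 ⊢
    have h0 := hsign0 _ _ h1
    rw [mul_assoc, LinearEquiv.mul_apply, height_zero_quarter] at h0
    obtain ⟨n, hn⟩ := p6 h0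
    change a₂ q hq ^ n = M at hn
    rcases hsign _ _ h1 with ⟨h, -⟩ | ⟨-, h'⟩
    · have := congrArg (height q 1) h
      rw [mul_assoc, LinearEquiv.mul_apply, height_one_quarter, height_one_one] at this
      change -height q 0 (M (v 1)) = _ at this
      linarith
    · refine ⟨n, ?_⟩
      change a₁ q hq ^ n = _
      have hconj : a₁ q hq = v * a₂ q hq * v⁻¹ := by
        rw [quarter_mul_a₂, mul_inv_cancel_right]
      rw [h', (commute_mu_neg_one _).eq, mul_assoc _ v, ← (commute_mu_neg_one v).eq,
        ← quarter_inv, ← hn, hconj, conj_zpow]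

/-! ### Cosets of the odd monodromy group -/

theorem quarter_mem_heckeC : quarter q hq ∈ heckeC q hq := by
  rw [heckeC_eq]
  exact Subgroup.subset_closure (by simp)

theorem a₁_mem : a₁ q hq ∈ oddMonodromy q hq := by
  rw [oddMonodromy_eq]
  exact Subgroup.subset_closure (by simp)

theorem a₂_mem : a₂ q hq ∈ oddMonodromy q hq := by
  rw [oddMonodromy_eq]
  exact Subgroup.subset_closure (by simp)

theorem oddMonodromy_le : oddMonodromy q hq ≤ heckeC q hq := by
  have ha : a₁ q hq ∈ heckeC q hq := by
    rw [heckeC_eq]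
    exact Subgroup.subset_closure (by simp)
  rw [oddMonodromy_eq, Subgroup.closure_le]
  rintro _ (rfl | rfl)
  · exact ha
  · rw [a₂_eq]
    exact mul_mem (mul_mem (quarter_mem_heckeC hq) ha) (inv_mem (quarter_mem_heckeC hq))

theorem quarter_mem_normalizer :
    quarter q hq ∈ Subgroup.normalizer (oddMonodromy q hq : Set (ℂ ≃ₗ[ℝ] ℂ)) := by
  set v := quarter q hq with hv
  have hconj : ∀ h ∈ oddMonodromy q hq, v * h * v⁻¹ ∈ oddMonodromy q hq := by
    intro h hh
    rw [oddMonodromy_eq] at hh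
    induction hh using Subgroup.closure_induction with
    | mem x hx =>
      rcases hx with rfl | rfl
      · rw [quarter_mul_a₁, mul_inv_cancel_right]
        exact a₂_mem hq
      · rw [quarter_mul_a₂, mul_inv_cancel_right]
        exact a₁_mem hq
    | one => simp [one_mem]
    | mul x y hx hy ihx ihy => simpa only [conj_mul] using mul_mem ihx ihy
    | inv x hx ih => simpa only [conj_inv] using inv_mem ih
  rw [Subgroup.mem_normalizer_iff]
  refine fun h => ⟨hconj h, fun hh => ?_⟩
  -- The square of the quarter turn is central, so conjugating by it twice is the identity.
  have h2 : v * (v * h * v⁻¹) * v⁻¹ = h :=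
    calc v * (v * h * v⁻¹) * v⁻¹ = v ^ 2 * h * (v ^ 2)⁻¹ := by
          rw [pow_two, mul_inv_rev]
          simp only [mul_assoc]
      _ = h := by rw [hv, quarter_sq, (commute_mu_neg_one h).eq, mul_inv_cancel_right]
  rw [← h2]
  exact hconj _ hh

theorem oddMonodromy_normal : ((oddMonodromy q hq).subgroupOf (heckeC q hq)).Normal := by
  rw [Subgroup.normal_subgroupOf_iff_le_normalizer (oddMonodromy_le hq), heckeC_eq,
    Subgroup.closure_le]
  rintro _ (rfl | rfl)
  · exact quarter_mem_normalizer hq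
  · exact Subgroup.le_normalizer (a₁_mem hq)

theorem quarter_zpow_conj_mem (n : ℤ) {h : ℂ ≃ₗ[ℝ] ℂ} (hh : h ∈ oddMonodromy q hq) :
    quarter q hq ^ n * h * (quarter q hq ^ n)⁻¹ ∈ oddMonodromy q hq :=
  (Subgroup.mem_normalizer_iff.1 (zpow_mem (quarter_mem_normalizer hq) n) h).1 hh

theorem exists_quarter_zpow_mul_mem {g : ℂ ≃ₗ[ℝ] ℂ} (hg : g ∈ heckeC q hq) :
    ∃ n : ℤ, quarter q hq ^ n * g ∈ oddMonodromy q hq := by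
  have key : ∀ a ∈ oddMonodromy q hq, ∀ y, (∃ n : ℤ, quarter q hq ^ n * y ∈ oddMonodromy q hq) →
      ∃ n : ℤ, quarter q hq ^ n * (a * y) ∈ oddMonodromy q hq := by
    rintro a ha y ⟨n, hn⟩
    refine ⟨n, ?_⟩
    convert mul_mem (quarter_zpow_conj_mem hq n ha) hn using 1
    group
  rw [heckeC_eq] at hg
  induction hg using Subgroup.closure_induction_left with
  | one => exact ⟨0, by simp [one_mem]⟩
  | mul_left x hx y hy ih =>
    rcases hx with rfl | rfl
    · obtain ⟨n, hn⟩ := ih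
      refine ⟨n - 1, ?_⟩
      rwa [zpow_sub_one, mul_assoc, inv_mul_cancel_left]
    · exact key _ (a₁_mem hq) y ih
  | inv_mul_cancel x hx y hy ih =>
    rcases hx with rfl | rfl
    · obtain ⟨n, hn⟩ := ih
      refine ⟨n + 1, ?_⟩
      rwa [zpow_add_one, mul_assoc, mul_inv_cancel_left]
    · exact key _ (inv_mem (a₁_mem hq)) y ih

/-- Modulo the odd monodromy group, multiplication by `ζ` agrees with the quarter turn. -/
theorem mu_zetaUnit_zpow_mem_iff (n : ℤ) :
    mu (zetaUnit q) ^ n ∈ oddMonodromy q hq ↔ quarter q hq ^ n ∈ oddMonodromy q hq := by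
  have h : mu (zetaUnit q) ^ n * (quarter q hq ^ n)⁻¹ ∈ oddMonodromy q hq := by
    induction n with
    | zero => simp [one_mem]
    | succ n ih =>
      rw [add_comm, zpow_one_add, zpow_one_add]
      nth_rewrite 1 [← a₁_mul_quarter hq]
      convert mul_mem (a₁_mem hq) (quarter_zpow_conj_mem hq 1 ih) using 1
      group
    | pred n ih =>
      rw [sub_eq_neg_add, zpow_add, zpow_add (quarter q hq), zpow_neg_one]
      nth_rewrite 1 [← a₁_mul_quarter hq]
      convert quarter_zpow_conj_mem hq (-1) (mul_mem (inv_mem (a₁_mem hq)) ih) using 1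
      group
  constructor
  · intro hu
    have := mul_mem (inv_mem h) hu
    rwa [mul_inv_rev, inv_inv, inv_mul_cancel_right] at this
  · intro hv
    have := mul_mem h hv
    rwa [inv_mul_cancel_right] at this

theorem zpowers_inf_oddMonodromy {d : ℕ}
    (hd : ∀ n : ℤ, quarter q hq ^ n ∈ oddMonodromy q hq ↔ (d : ℤ) ∣ n) :
    Subgroup.zpowers (mu (zetaUnit q)) ⊓ oddMonodromy q hq =
      Subgroup.zpowers (mu (zetaUnit q ^ d)) := by
  ext g
  constructor
  · rintro ⟨⟨n, rfl⟩, hn⟩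
    obtain ⟨m, rfl⟩ := (hd n).1 ((mu_zetaUnit_zpow_mem_iff hq n).1 hn)
    exact ⟨m, by simp [zpow_mul]⟩
  · rintro ⟨n, rfl⟩
    have h : mu (zetaUnit q ^ d) ^ n = mu (zetaUnit q) ^ (d * n : ℤ) := by
      rw [map_pow, zpow_mul, zpow_natCast]
    change mu (zetaUnit q ^ d) ^ n ∈ _
    rw [h]
    exact ⟨⟨_, rfl⟩, (mu_zetaUnit_zpow_mem_iff hq _).2 ((hd _).2 ⟨n, rfl⟩)⟩

theorem relIndex_zpowers {d : ℕ}
    (hd : ∀ n : ℤ, quarter q hq ^ n ∈ oddMonodromy q hq ↔ (d : ℤ) ∣ n) :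
    (Subgroup.zpowers (mu (zetaUnit q ^ d))).relIndex (Subgroup.zpowers (mu (zetaUnit q))) = d := by
  rw [← zpowers_inf_oddMonodromy hq hd]
  refine relIndex_eq_of_cyclic_quotient inferInstance (Subgroup.mem_zpowers _) ?_ ?_
  · rintro _ ⟨n, rfl⟩
    refine ⟨-n, ?_⟩
    simp [one_mem]
  · intro n
    rw [← hd n, ← mu_zetaUnit_zpow_mem_iff hq]
    exact ⟨fun h => h.2, fun h => ⟨⟨n, rfl⟩, h⟩⟩

theorem oddMonodromy_relIndex {d : ℕ}
    (hd : ∀ n : ℤ, quarter q hq ^ n ∈ oddMonodromy q hq ↔ (d : ℤ) ∣ n) :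
    (oddMonodromy q hq).relIndex (heckeC q hq) = d :=
  relIndex_eq_of_cyclic_quotient (oddMonodromy_normal hq) (quarter_mem_heckeC hq)
    (fun _ hg => exists_quarter_zpow_mul_mem hq hg) hd

theorem mem_orbit_oddMonodromy {z w : ℂ} :
    z ∈ MulAction.orbit (oddMonodromy q hq) w ↔ ∃ h ∈ oddMonodromy q hq, h w = z :=
  ⟨fun ⟨h, hh⟩ => ⟨h, h.2, hh⟩, fun ⟨h, hm, hh⟩ => ⟨⟨h, hm⟩, hh⟩⟩

/-- The orbits of the odd monodromy group on the odd vanishing cycles are those of `vᵐ 1`, where `v`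
is the quarter turn and `m` runs over the residues modulo its order `d` in the quotient. -/
theorem mem_oddCycles_iff {d : ℕ} (hd0 : 0 < d)
    (hd : ∀ n : ℤ, quarter q hq ^ n ∈ oddMonodromy q hq ↔ (d : ℤ) ∣ n) {z : ℂ} :
    z ∈ oddCycles q hq ↔
      ∃ m < d, z ∈ MulAction.orbit (oddMonodromy q hq) ((quarter q hq ^ m) 1) := by
  simp only [mem_oddCycles, mem_orbit_oddMonodromy]
  constructor
  · rintro ⟨g, hg, rfl⟩
    obtain ⟨n, hn⟩ := exists_quarter_zpow_mul_mem hq hg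
    have hd1 : (0 : ℤ) < d := by exact_mod_cast hd0
    have h0 := Int.emod_nonneg (-n) hd1.ne'
    have h1 := Int.emod_lt_of_pos (-n) hd1
    have h2 := Int.emod_add_mul_ediv (-n) d
    obtain ⟨m, hm⟩ := Int.eq_ofNat_of_zero_le h0
    rw [hm] at h1 h2
    have hk : quarter q hq ^ (-n - m) ∈ oddMonodromy q hq := (hd _).2 ⟨-n / d, by linarith⟩
    refine ⟨m, by exact_mod_cast h1, g * (quarter q hq ^ m)⁻¹, ?_, ?_⟩
    · convert mul_mem (quarter_zpow_conj_mem hq (-n) hn) hk using 1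
      rw [← zpow_natCast]
      group
    · rw [← LinearEquiv.mul_apply, inv_mul_cancel_right]
  · rintro ⟨m, -, h, hh, rfl⟩
    exact ⟨h * quarter q hq ^ m,
      mul_mem (oddMonodromy_le hq hh) (pow_mem (quarter_mem_heckeC hq) m), rfl⟩

/-- If the orbits of `vᵐ 1` and `vˡ 1` met, the stabilizer of `1` would contain an element in the
coset of `vˡ⁻ᵐ`, but it is generated by `a₁`. -/
theorem disjoint_orbit {d : ℕ}
    (hd : ∀ n : ℤ, quarter q hq ^ n ∈ oddMonodromy q hq ↔ (d : ℤ) ∣ n) {m l : ℕ}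
    (hml : ¬ (d : ℤ) ∣ l - m) :
    Disjoint (MulAction.orbit (oddMonodromy q hq) ((quarter q hq ^ m) 1))
      (MulAction.orbit (oddMonodromy q hq) ((quarter q hq ^ l) 1)) := by
  rw [Set.disjoint_left]
  intro z hz hz'
  obtain ⟨h, hh, rfl⟩ := (mem_orbit_oddMonodromy hq).1 hz
  obtain ⟨k, hk, hkh⟩ := (mem_orbit_oddMonodromy hq).1 hz'
  have hv := quarter_mem_heckeC hq
  have hfix : ((h * quarter q hq ^ m)⁻¹ * (k * quarter q hq ^ l)) 1 = 1 := by
    rw [LinearEquiv.mul_apply, LinearEquiv.mul_apply k, hkh, ← LinearEquiv.mul_apply h,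
      ← LinearEquiv.mul_apply, inv_mul_cancel]
    rfl
  have hmem := mem_zpowers_a₁_of_apply_one hq
    (mul_mem (inv_mem (mul_mem (oddMonodromy_le hq hh) (pow_mem hv m)))
      (mul_mem (oddMonodromy_le hq hk) (pow_mem hv l))) hfix
  have hmem' := (Subgroup.zpowers_le.2 (a₁_mem hq)) hmem
  refine hml ((hd _).1 ?_)
  convert mul_mem (quarter_zpow_conj_mem hq (-m) (mul_mem (inv_mem hk) hh)) hmem' using 1
  rw [← zpow_natCast, ← zpow_natCast]
  group

/-! ### The order of the quarter turn modulo the odd monodromy group -/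

theorem quarter_mem_of_odd (h : q % 2 = 1) : quarter q hq ∈ oddMonodromy q hq := by
  obtain ⟨k, hk⟩ : ∃ k, q = 2 * k + 1 := ⟨q / 2, by omega⟩
  have h1 : quarter q hq = ((a₁ q hq * a₂ q hq) ^ k * a₁ q hq)⁻¹ * mu (-1) ^ (k + 1) := by
    rw [a₁_mul_a₂_pow_of_odd hq hk, mul_inv_rev, inv_inv, inv_mul_cancel_right]
  rw [h1]
  exact mul_mem (inv_mem (mul_mem (pow_mem (mul_mem (a₁_mem hq) (a₂_mem hq)) _) (a₁_mem hq)))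
    (pow_mem (mu_neg_one_mem_of_not_two hq (by omega)) _)

theorem quarter_notMem_of_even (h : q % 2 = 0) : quarter q hq ∉ oddMonodromy q hq :=
  fun hm => conj_a₁_ne_a₂_of_even hq h hm (quarter_mul_a₁ hq)

theorem mu_neg_one_mul_quarter_notMem_of_even (h : q % 2 = 0) :
    mu (-1) * quarter q hq ∉ oddMonodromy q hq := by
  intro hm
  refine conj_a₁_ne_a₂_of_even hq h hm ?_
  rw [mul_assoc, quarter_mul_a₁, ← mul_assoc, (commute_mu_neg_one _).eq, mul_assoc]

theorem quarter_zpow_mem_iff_of_odd (h : q % 2 = 1) (n : ℤ) :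
    quarter q hq ^ n ∈ oddMonodromy q hq ↔ ((1 : ℕ) : ℤ) ∣ n := by
  simpa using zpow_mem (quarter_mem_of_odd hq h) n

theorem quarter_zpow_mem_iff_of_zero (h : q % 4 = 0) (n : ℤ) :
    quarter q hq ^ n ∈ oddMonodromy q hq ↔ ((2 : ℕ) : ℤ) ∣ n := by
  have hm : ∀ m : ℤ, mu (-1) ^ m ∈ oddMonodromy q hq :=
    fun m => zpow_mem (mu_neg_one_mem_of_not_two hq (by omega)) m
  rcases Int.even_or_odd' n with ⟨m, rfl | rfl⟩
  · rw [quarter_zpow_two_mul]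
    exact iff_of_true (hm m) ⟨m, rfl⟩
  · rw [zpow_add_one, quarter_zpow_two_mul, Subgroup.mul_mem_cancel_left _ (hm m)]
    exact iff_of_false (quarter_notMem_of_even hq (by omega)) (by omega)

theorem quarter_zpow_mem_iff_of_two (h : q % 4 = 2) (n : ℤ) :
    quarter q hq ^ n ∈ oddMonodromy q hq ↔ ((4 : ℕ) : ℤ) ∣ n := by
  have h2 : mu (-1) ^ (2 : ℤ) = 1 := by rw [zpow_ofNat, mu_neg_one_sq]
  have hm : ∀ m : ℤ, mu (-1) ^ (2 * m) = 1 := fun m => by rw [zpow_mul, h2, one_zpow]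
  rcases Int.even_or_odd' n with ⟨m, rfl | rfl⟩ <;> rcases Int.even_or_odd' m with ⟨l, rfl | rfl⟩
  · rw [quarter_zpow_two_mul, hm]
    exact iff_of_true (one_mem _) (by omega)
  · rw [quarter_zpow_two_mul, zpow_add_one, hm, one_mul]
    exact iff_of_false (mu_neg_one_notMem_of_two hq h) (by omega)
  · rw [zpow_add_one, quarter_zpow_two_mul, hm, one_mul]
    exact iff_of_false (quarter_notMem_of_even hq (by omega)) (by omega)
  · rw [zpow_add_one, quarter_zpow_two_mul, zpow_add_one, hm, one_mul]
    exact iff_of_false (mu_neg_one_mul_quarter_notMem_of_even hq (by omega)) (by omega)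

end

end OddHecke

end

open OddHecke in
theorem theorem9p2 (q : ℕ) (hq : 3 ≤ q) :
    oddMonodromy q hq = Subgroup.closure {a₁ q hq, a₂ q hq} ∧
    (q % 2 = 1 →
      oddMonodromy q hq = heckeC q hq ∧
      mu (-1) ∈ oddMonodromy q hq ∧
      oddCycles q hq = MulAction.orbit (oddMonodromy q hq) (1 : ℂ)) ∧
    (q % 4 = 0 →
      oddMonodromy q hq ≤ heckeC q hq ∧
      ((oddMonodromy q hq).subgroupOf (heckeC q hq)).Normal ∧
      (oddMonodromy q hq).relIndex (heckeC q hq) = 2 ∧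
      mu (-1) ∈ oddMonodromy q hq ∧
      Subgroup.zpowers (mu (zetaUnit q)) ⊓ oddMonodromy q hq =
        Subgroup.zpowers (mu (zetaUnit q ^ 2)) ∧
      (Subgroup.zpowers (mu (zetaUnit q ^ 2))).relIndex
        (Subgroup.zpowers (mu (zetaUnit q))) = 2 ∧
      oddCycles q hq = MulAction.orbit (oddMonodromy q hq) (1 : ℂ) ∪
        MulAction.orbit (oddMonodromy q hq) (zeta q ^ (q - 1)) ∧
      Disjoint (MulAction.orbit (oddMonodromy q hq) (1 : ℂ))
        (MulAction.orbit (oddMonodromy q hq) (zeta q ^ (q - 1)))) ∧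
    (q % 4 = 2 →
      oddMonodromy q hq ≤ heckeC q hq ∧
      ((oddMonodromy q hq).subgroupOf (heckeC q hq)).Normal ∧
      (oddMonodromy q hq).relIndex (heckeC q hq) = 4 ∧
      mu (-1) ∉ oddMonodromy q hq ∧
      Subgroup.zpowers (mu (zetaUnit q)) ⊓ oddMonodromy q hq =
        Subgroup.zpowers (mu (zetaUnit q ^ 4)) ∧
      (Subgroup.zpowers (mu (zetaUnit q ^ 4))).relIndex
        (Subgroup.zpowers (mu (zetaUnit q))) = 4 ∧
      oddCycles q hq = MulAction.orbit (oddMonodromy q hq) (1 : ℂ) ∪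
        MulAction.orbit (oddMonodromy q hq) (-1 : ℂ) ∪
        MulAction.orbit (oddMonodromy q hq) (zeta q ^ (q - 1)) ∪
        MulAction.orbit (oddMonodromy q hq) (-zeta q ^ (q - 1)) ∧
      List.Pairwise Disjoint
        [MulAction.orbit (oddMonodromy q hq) (1 : ℂ),
          MulAction.orbit (oddMonodromy q hq) (-1 : ℂ),
          MulAction.orbit (oddMonodromy q hq) (zeta q ^ (q - 1)),
          MulAction.orbit (oddMonodromy q hq) (-zeta q ^ (q - 1))]) ∧
    ∃ (h₁ : a₁ q hq ∈ oddMonodromy q hq) (h₂ : a₂ q hq ∈ oddMonodromy q hq)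
      (φ : oddMonodromy q hq ≃* PresentedGroup (oddRels q)),
      φ ⟨a₁ q hq, h₁⟩ = PresentedGroup.of 0 ∧ φ ⟨a₂ q hq, h₂⟩ = PresentedGroup.of 1 := by 
  have hv2 : (quarter q hq ^ 2) 1 = (-1 : ℂ) := by rw [quarter_sq, mu_neg_one_apply]
  have hv3 : (quarter q hq ^ 3) 1 = -zeta q ^ (q - 1) := by
    rw [pow_succ', LinearEquiv.mul_apply, hv2, map_neg, quarter_one]
  have hv1 : (quarter q hq ^ 1) 1 = zeta q ^ (q - 1) := by rw [pow_one, quarter_one]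
  have hv0 : (quarter q hq ^ 0) 1 = (1 : ℂ) := rfl
  refine ⟨oddMonodromy_eq hq, ?_, ?_, ?_, ?_⟩
  · intro h
    refine ⟨le_antisymm (oddMonodromy_le hq) ?_, mu_neg_one_mem_of_not_two hq (by omega), ?_⟩
    · rw [heckeC_eq, Subgroup.closure_le]
      rintro _ (rfl | rfl)
      · exact quarter_mem_of_odd hq h
      · exact a₁_mem hq
    · ext z
      rw [mem_oddCycles_iff hq one_pos (quarter_zpow_mem_iff_of_odd hq h)]
      simp only [Nat.lt_one_iff, exists_eq_left, hv0]
  · intro h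
    have hd := quarter_zpow_mem_iff_of_zero hq h
    refine ⟨oddMonodromy_le hq, oddMonodromy_normal hq, oddMonodromy_relIndex hq hd,
      mu_neg_one_mem_of_not_two hq (by omega), zpowers_inf_oddMonodromy hq hd,
      relIndex_zpowers hq hd, ?_, ?_⟩
    · ext z
      rw [mem_oddCycles_iff hq two_pos hd]
      simp only [Set.mem_union]
      constructor
      · rintro ⟨m, hm, hz⟩
        interval_cases m <;> simp only [hv0, hv1] at hz <;> tauto
      · rintro (hz | hz)
        · exact ⟨0, by norm_num, by rwa [hv0]⟩
        · exact ⟨1, by norm_num, by rwa [hv1]⟩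
    · have := disjoint_orbit hq hd (m := 0) (l := 1) (by norm_num)
      rwa [hv0, hv1] at this
  · intro h
    have hd := quarter_zpow_mem_iff_of_two hq h
    refine ⟨oddMonodromy_le hq, oddMonodromy_normal hq, oddMonodromy_relIndex hq hd,
      mu_neg_one_notMem_of_two hq h, zpowers_inf_oddMonodromy hq hd,
      relIndex_zpowers hq hd, ?_, ?_⟩
    · ext z
      rw [mem_oddCycles_iff hq four_pos hd]
      simp only [Set.mem_union]
      constructor
      · rintro ⟨m, hm, hz⟩
        interval_cases m <;> simp only [hv0, hv1, hv2, hv3] at hz <;> tauto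
      · rintro (((hz | hz) | hz) | hz)
        · exact ⟨0, by norm_num, by rwa [hv0]⟩
        · exact ⟨2, by norm_num, by rwa [hv2]⟩
        · exact ⟨1, by norm_num, by rwa [hv1]⟩
        · exact ⟨3, by norm_num, by rwa [hv3]⟩
    · have key := fun m l : ℕ => disjoint_orbit hq hd (m := m) (l := l)
      rw [← hv3, ← hv2, ← hv1, ← hv0]
      simp only [List.pairwise_cons, List.mem_cons, List.not_mem_nil, or_false, forall_eq_or_imp,
        forall_eq, List.Pairwise.nil, and_true, IsEmpty.forall_iff, implies_true]
      exact ⟨⟨key 0 2 (by norm_num), key 0 1 (by norm_num), key 0 3 (by norm_num)⟩,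
        ⟨key 2 1 (by norm_num), key 2 3 (by norm_num)⟩, key 1 3 (by norm_num)⟩
  · exact ⟨a₁_mem hq, a₂_mem hq, monodromyEquiv hq, monodromyEquiv_eq hq _ (monodromyHom_zero hq),
      monodromyEquiv_eq hq _ (monodromyHom_one hq)⟩
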